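/- There are absolute constants $c>0$ and $C>0$ and a function $\varepsilon:\mathbb N\to\mathbb R$ with $\varepsilon(d)\to 0$ as $d\to\infty$ such that the following holds for all $d$ and $m$ with $m\le c\,d^2$. Let $v_1,\dots,v_m$ be i.i.d. samples from $\mathcal N(0,\frac1d I_d)$, and let $M_\alpha,M_\beta,M_D\in\mathbb R^{m\times m}$ be the following matrices: $M_\alpha$ and $M_\beta$ have zero diagonal and, for $i\ne j$, $$M_\alpha[i,j]=\sum_{a\neq b\in[d]} v_i[a]\,v_i[b]\,v_j[a]\,v_j[b],\qquad M_\beta[i,j]=\sum_{a\in[d]}\Bigl(v_i[a]^2-\tfrac1d\Bigr)\Bigl(v_j[a]^2-\tfrac1d\Bigr)$$ (the first sum is over ordered pairs $(a,b)$), while $M_D$ is the diagonal matrix with $$M_D[i,i]=\|v_i\|_2^4-\tfrac2d\|v_i\|_2^2-1 .$$ Then, with probability at least $1-\varepsilon(d)$, the following three bounds hold simultaneously: $$\|M_\alpha\|_{\mathrm{op}}\le 0.1,\qquad \|M_\beta\|_{\mathrm{op}}\le 0.1,\qquad \|M_D\|_{\mathrm{op}}\le C\sqrt{\frac{\log d}{d}},$$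 where $\|\cdot\|_{\mathrm{op}}$ is the spectral norm. (These matrices are the parts of the decomposition $M=M_\alpha+M_\beta+M_D+(1+\frac1d)I_m+\frac1d J_m+\frac1d(1_m\eta^T+\eta 1_m^T)$ of the matrix $M[i,j]=\langle v_i,v_j\rangle^2$, where $J_m$ is the all-ones matrix, $1_m$ the all-ones vector and $\eta_i=\|v_i\|_2^2-1$.) -/

import Mathlib

open MeasureTheory ProbabilityTheory Filter Topology

/-- `M_α[i,j] = ∑_{a ≠ b} v_i[a] v_i[b] v_j[a] v_j[b]` for `i ≠ j` (sum over ordered pairs `(a,b)`),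
with zero diagonal. -/
noncomputable def Malpha {d m : ℕ} (v : Fin m → EuclideanSpace ℝ (Fin d)) :
    Matrix (Fin m) (Fin m) ℝ :=
  Matrix.of fun i j =>
    if i = j then 0
    else ∑ a : Fin d, ∑ b : Fin d, if a = b then 0 else v i a * v i b * v j a * v j b

/-- `M_β[i,j] = ∑_a (v_i[a]² - 1/d) (v_j[a]² - 1/d)` for `i ≠ j`, with zero diagonal. -/
noncomputable def Mbeta {d m : ℕ} (v : Fin m → EuclideanSpace ℝ (Fin d)) :
    Matrix (Fin m) (Fin m) ℝ :=
  Matrix.of fun i j =>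
    if i = j then 0
    else ∑ a : Fin d, ((v i a) ^ 2 - 1 / (d : ℝ)) * ((v j a) ^ 2 - 1 / (d : ℝ))

/-- The diagonal matrix with entries `M_D[i,i] = ‖v_i‖⁴ - (2/d) ‖v_i‖² - 1`. -/
noncomputable def Mdiag {d m : ℕ} (v : Fin m → EuclideanSpace ℝ (Fin d)) :
    Matrix (Fin m) (Fin m) ℝ :=
  Matrix.diagonal fun i => ‖v i‖ ^ 4 - 2 / (d : ℝ) * ‖v i‖ ^ 2 - 1

/-- The operator (spectral) norm of a real square matrix, with respect to the Euclidean norm. -/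
noncomputable def opNorm {m : ℕ} (A : Matrix (Fin m) (Fin m) ℝ) : ℝ :=
  ‖Matrix.toEuclideanCLM (n := Fin m) (𝕜 := ℝ) A‖

/-- `v_1, …, v_m` are i.i.d. samples from `N(0, (1/d) I_d)`. -/
structure IsIIDGaussianSample {Ω : Type*} [MeasurableSpace Ω] (P : Measure Ω) (d m : ℕ)
    (v : Fin m → Ω → EuclideanSpace ℝ (Fin d)) : Prop where
  indep : iIndepFun v P
  law : ∀ i, HasLaw (v i)
    (multivariateGaussian 0 ((1 / (d : ℝ)) • (1 : Matrix (Fin d) (Fin d) ℝ))) P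

/-! `Malpha` and `Mbeta` are the off-diagonal parts of Gram matrices of i.i.d. features w_i
(`offDiagFeature`, `diagFeature`). Diagonalizing quadratic forms in a Gaussian vector shows that
every marginal of w_i is sub-exponential at scale 1/d (`HasSubexpMarginals`), and ‖w_i‖² ≤ 2 once
‖v_i‖² is close to 1.

Put n = (d/240000)² ≥ m and test the quadratic form on Σ z_i² ≤ n. Since the diagonal is zero, the
form is affine in each coordinate, so passing to vertices of boxes (`exists_vertex_le`) rounds z to
entries 0, ±2^l and separates the form into two disjoint supports, at the cost of constants only.
The product is then split by dyadic level, so that one factor x has a single level k and the other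
factor y has levels at least k. Given Y = Σ y_j w_j, the inner product of Σ x_i w_i with Y/‖Y‖ is a
sum of independent sub-exponential variables, and its Chernoff bound beats the exponential of
O(n(k+1)/4^k) pairs (x, y) (`measure_not_levelBounds_le`). The resulting bounds are summable in k,
with total O(n/d) times a bound M on the norms ‖Y‖ (`LevelBounds.inner_le`).

The argument closes on itself: with B the operator norm, ‖Y‖² ≤ 5n(B + 2), whence B ≤ (3840/d)√(5n(B
+ 2)), and smallness of n/d² forces B ≤ 0.1 (`LevelBounds.opNorm_le`). The diagonal matrix only
needs a chi-square tail and a union bound over at most d² indices. -/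

/-! ### Exponential moments of Gaussian quadratic forms -/

/-- Equivalent to -log(1 - w) ≤ w + w²; it turns the exact chi-square moment generating function
into a sub-Gaussian bound near 0. -/
lemma one_le_one_sub_mul_exp {w : ℝ} (h : |w| ≤ 1 / 2) : 1 ≤ (1 - w) * Real.exp (w + w ^ 2) := by
  obtain ⟨h1, h2⟩ := abs_le.1 h
  rcases le_total 0 w with h0 | h0
  · have h3 := Real.quadratic_le_exp_of_nonneg (x := w + w ^ 2) (by positivity)
    have h4 : (1 - w) * (1 + (w + w ^ 2) + (w + w ^ 2) ^ 2 / 2) ≤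
        (1 - w) * Real.exp (w + w ^ 2) := by
      apply mul_le_mul_of_nonneg_left h3; linarith
    have h5 : 0 ≤ w ^ 2 * ((1 - w) * (1 + w) ^ 2 / 2 - w) := by
      apply mul_nonneg (sq_nonneg _)
      nlinarith [mul_nonneg h0 h0, mul_nonneg h0 (by linarith : 0 ≤ 1/2 - w),
        mul_nonneg (mul_nonneg h0 h0) (by linarith : 0 ≤ 1/2 - w)]
    nlinarith
  · have h3 := Real.add_one_le_exp (w + w ^ 2)
    have h4 : (1 - w) * (w + w ^ 2 + 1) ≤ (1 - w) * Real.exp (w + w ^ 2) := by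
      apply mul_le_mul_of_nonneg_left h3; linarith
    have h5 : 0 ≤ (-w) * w ^ 2 := by apply mul_nonneg (by linarith) (sq_nonneg _)
    nlinarith

/-- Exponential moments of a centered squared standard Gaussian. -/
lemma lintegral_exp_sq_sub_one_le {u : ℝ} (hu : |u| ≤ 1 / 4) :
    ∫⁻ x, ENNReal.ofReal (Real.exp (u * (x ^ 2 - 1))) ∂(gaussianReal 0 1) ≤
      ENNReal.ofReal (Real.exp (2 * u ^ 2)) := by
  obtain ⟨h1, h2⟩ := abs_le.1 hu
  have hb : 0 < 1 / 2 - u := by linarith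
  rw [gaussianReal_of_var_ne_zero _ one_ne_zero,
    lintegral_withDensity_eq_lintegral_mul _ (by fun_prop) (by fun_prop)]
  have e : ∀ x : ℝ, (gaussianPDF 0 1 * fun x => ENNReal.ofReal (Real.exp (u * (x ^ 2 - 1)))) x =
      ENNReal.ofReal ((√(2 * Real.pi))⁻¹ * Real.exp (-u) *
        Real.exp (-(1 / 2 - u) * x ^ 2)) := by
    intro x
    simp only [Pi.mul_apply, gaussianPDF, gaussianPDFReal]
    rw [← ENNReal.ofReal_mul (by positivity)]
    congr 1
    rw [mul_assoc (√(2 * Real.pi))⁻¹ _ _, mul_assoc _ _ (Real.exp _), ← Real.exp_add, ← Real.exp_add]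
    simp only [NNReal.coe_one, mul_one]
    congr 2
    ring
  simp_rw [e]
  rw [← ofReal_integral_eq_lintegral_ofReal]
  · apply ENNReal.ofReal_le_ofReal
    rw [integral_const_mul, integral_gaussian]
    have hpi := Real.pi_pos
    have e2 : √(Real.pi / (1 / 2 - u)) = √(2 * Real.pi) * (√(1 - 2 * u))⁻¹ := by
      rw [← Real.sqrt_inv, ← Real.sqrt_mul (by positivity)]
      congr 1
      have : 1 - 2 * u ≠ 0 := by linarith
      have := hb.ne'
      field_simp
    rw [e2]
    have h3 : √(2 * Real.pi) ≠ 0 := by positivity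
    have h5 : 0 < 1 - 2 * u := by linarith
    have h6 : 0 < √(1 - 2 * u) := Real.sqrt_pos.2 h5
    have e3 : (√(2 * Real.pi))⁻¹ * Real.exp (-u) * (√(2 * Real.pi) * (√(1 - 2 * u))⁻¹) =
      Real.exp (-u) * (√(1 - 2 * u))⁻¹ := by field_simp
    rw [e3, ← div_eq_mul_inv, div_le_iff₀ h6]
    -- The integral equals exp(-u)/√(1 - 2u). Squaring removes the root and leaves
    -- `one_le_one_sub_mul_exp` at w = 2u.
    apply le_of_sq_le_sq _ (by positivity)
    rw [mul_pow, Real.sq_sqrt h5.le, ← Real.exp_nat_mul, ← Real.exp_nat_mul]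
    have := one_le_one_sub_mul_exp (w := 2 * u) (by rw [abs_mul]; norm_num; linarith)
    calc Real.exp ((2 : ℕ) * -u) = Real.exp ((2 : ℕ) * -u) * 1 := by ring
      _ ≤ Real.exp ((2 : ℕ) * -u) * ((1 - 2 * u) * Real.exp (2 * u + (2 * u) ^ 2)) := by gcongr
      _ = (Real.exp ((2 : ℕ) * -u) * Real.exp (2 * u + (2 * u) ^ 2)) * (1 - 2 * u) := by ring
      _ = _ := by
        rw [← Real.exp_add]; congr 2; push_cast; ring
  · exact (integrable_exp_neg_mul_sq hb).const_mul _
  · exact ae_of_all _ fun x => by positivity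

lemma multivariateGaussian_smul_one_eq_map {d : ℕ} {s : ℝ} (hs : 0 ≤ s) :
    multivariateGaussian 0 (s • (1 : Matrix (Fin d) (Fin d) ℝ)) =
      (stdGaussian (EuclideanSpace ℝ (Fin d))).map (fun x => √s • x) := by
  apply Measure.ext_of_charFun
  ext t
  have hS : (s • (1 : Matrix (Fin d) (Fin d) ℝ)).PosSemidef := Matrix.PosSemidef.one.smul hs
  rw [charFun_multivariateGaussian hS, charFun_map_smul, charFun_stdGaussian]
  congr 1
  rw [← Complex.ofReal_pow, norm_smul, mul_pow, Real.norm_eq_abs, sq_abs, Real.sq_sqrt hs,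
    EuclideanSpace.real_norm_sq_eq]
  simp [Matrix.smul_mulVec, dotProduct, pow_two, neg_div]
  rw [Finset.mul_sum]
  exact Finset.sum_congr rfl fun _ _ => by ring

/-- Exponential moments of a diagonalized centered Gaussian quadratic form. -/
lemma lintegral_exp_sum_sq_le {d : ℕ} (hd : 0 < d)
    (b : OrthonormalBasis (Fin d) ℝ (EuclideanSpace ℝ (Fin d))) (μ : Fin d → ℝ)
    (hμ : ∀ a, |μ a| ≤ d / 4) :
    ∫⁻ v, ENNReal.ofReal (Real.exp (∑ a, μ a * ((inner ℝ (b a) v) ^ 2 - 1 / d)))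
      ∂(multivariateGaussian 0 ((1 / (d : ℝ)) • (1 : Matrix (Fin d) (Fin d) ℝ))) ≤
      ENNReal.ofReal (Real.exp (2 * (∑ a, μ a ^ 2) / d ^ 2)) := by
  have hd' : (0 : ℝ) < d := by exact_mod_cast hd
  rw [multivariateGaussian_smul_one_eq_map (by positivity),
    stdGaussian_eq_map_pi_orthonormalBasis b, lintegral_map (by fun_prop) (by fun_prop),
    lintegral_map (by fun_prop) (by fun_prop)]
  have e : ∀ x : Fin d → ℝ, ENNReal.ofReal (Real.exp (∑ a, μ a *
      ((inner ℝ (b a) (√(1 / (d : ℝ)) • ∑ i, x i • b i)) ^ 2 - 1 / d))) =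
      ∏ a, ENNReal.ofReal (Real.exp (μ a / d * (x a ^ 2 - 1))) := by
    intro x
    rw [Real.exp_sum, ENNReal.ofReal_prod_of_nonneg (fun _ _ => (Real.exp_pos _).le)]
    refine Finset.prod_congr rfl fun a _ => ?_
    congr 2
    rw [inner_smul_right, b.orthonormal.inner_right_fintype, mul_pow,
      Real.sq_sqrt (by positivity)]
    field_simp
  simp_rw [e]
  have hi : iIndepFun (fun a (x : Fin d → ℝ) =>
      ENNReal.ofReal (Real.exp (μ a / d * (x a ^ 2 - 1))))
      (Measure.pi fun _ : Fin d => gaussianReal 0 1) :=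
    iIndepFun_pi (X := fun a x => ENNReal.ofReal (Real.exp (μ a / d * (x ^ 2 - 1))))
      (fun a => by fun_prop)
  have := lintegral_prod_eq_prod_lintegral_of_indepFun Finset.univ _ hi (fun a => by fun_prop)
  rw [this]
  calc _ ≤ ∏ a, ENNReal.ofReal (Real.exp (2 * (μ a / d) ^ 2)) := by
        refine Finset.prod_le_prod' fun a _ => ?_
        have h := (measurePreserving_eval (fun _ : Fin d => gaussianReal 0 1) a).lintegral_comp
          (f := fun x => ENNReal.ofReal (Real.exp (μ a / d * (x ^ 2 - 1)))) (by fun_prop)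
        simp only [Function.eval] at h
        rw [h]
        apply lintegral_exp_sq_sub_one_le
        rw [abs_div, abs_of_pos hd', div_le_iff₀ hd']
        linarith [hμ a]
    _ = _ := by
        rw [← ENNReal.ofReal_prod_of_nonneg (fun _ _ => (Real.exp_pos _).le), ← Real.exp_sum]
        congr 2
        rw [Finset.mul_sum, Finset.sum_div]
        refine Finset.sum_congr rfl fun a _ => ?_
        field_simp

/-! ### Diagonalization of symmetric matrices -/

section spectral
variable {d : ℕ} {S : Matrix (Fin d) (Fin d) ℝ}

lemma inner_eigenvectorBasis_mulVec (hS : S.IsHermitian) (a : Fin d)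
    (v : EuclideanSpace ℝ (Fin d)) :
    inner ℝ (hS.eigenvectorBasis a) (WithLp.toLp 2 (S.mulVec v)) =
      hS.eigenvalues a * inner ℝ (hS.eigenvectorBasis a) v := by
  have hT : S.transpose = S := by
    have h := hS.eq
    rwa [Matrix.conjTranspose_eq_transpose_of_trivial] at h
  rw [EuclideanSpace.inner_eq_star_dotProduct, EuclideanSpace.inner_eq_star_dotProduct]
  simp only [star_trivial]
  rw [dotProduct_comm, Matrix.dotProduct_mulVec, ← Matrix.mulVec_transpose, hT,
    hS.mulVec_eigenvectorBasis, smul_dotProduct, dotProduct_comm, smul_eq_mul]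

lemma sum_eigenvalues_mul_inner_sq (hS : S.IsHermitian) (v : EuclideanSpace ℝ (Fin d)) :
    ∑ a, hS.eigenvalues a * (inner ℝ (hS.eigenvectorBasis a) v) ^ 2 =
      ∑ a, ∑ b, S a b * (v a * v b) := by
  have h := hS.eigenvectorBasis.sum_inner_mul_inner v (WithLp.toLp 2 (S.mulVec v))
  simp_rw [inner_eigenvectorBasis_mulVec] at h
  calc _ = ∑ a, inner ℝ v (hS.eigenvectorBasis a) *
        (hS.eigenvalues a * inner ℝ (hS.eigenvectorBasis a) v) := by
        refine Finset.sum_congr rfl fun a _ => ?_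
        rw [real_inner_comm]; ring
    _ = _ := by
        rw [h, PiLp.inner_apply]
        refine Finset.sum_congr rfl fun a _ => ?_
        simp only [Matrix.mulVec, dotProduct, RCLike.inner_apply, conj_trivial, Finset.sum_mul]
        exact Finset.sum_congr rfl fun b _ => by ring

/-- The squared Frobenius norm is the sum of ‖S e_c‖² over the standard basis; Parseval in the
eigenbasis, then in the standard basis, gives the eigenvalue form. -/
lemma sum_eigenvalues_sq (hS : S.IsHermitian) :
    ∑ a, hS.eigenvalues a ^ 2 = ∑ a, ∑ b, S a b ^ 2 := by
  have h : ∀ c, ∑ b, S b c ^ 2 =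
      ∑ a, hS.eigenvalues a ^ 2 * (inner ℝ (hS.eigenvectorBasis a)
        (EuclideanSpace.basisFun (Fin d) ℝ c)) ^ 2 := by
    intro c
    have h := hS.eigenvectorBasis.sum_sq_inner_right
      (WithLp.toLp 2 (S.mulVec (EuclideanSpace.basisFun (Fin d) ℝ c)))
    simp_rw [inner_eigenvectorBasis_mulVec, mul_pow] at h
    rw [h, EuclideanSpace.real_norm_sq_eq]
    simp
  rw [Finset.sum_comm]
  simp_rw [h]
  rw [Finset.sum_comm]
  refine Finset.sum_congr rfl fun a _ => ?_
  rw [← Finset.mul_sum]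
  simp_rw [fun c => real_inner_comm (EuclideanSpace.basisFun (Fin d) ℝ c)
    (hS.eigenvectorBasis a)]
  rw [(EuclideanSpace.basisFun (Fin d) ℝ).sum_sq_inner_right]
  simp

end spectral

/-! ### The feature vectors and their marginals -/

/-- The off-diagonal part of `v vᵀ`, as a vector. -/
noncomputable def offDiagFeature {d : ℕ} (v : EuclideanSpace ℝ (Fin d)) :
    EuclideanSpace ℝ (Fin d × Fin d) :=
  WithLp.toLp 2 fun p => if p.1 = p.2 then 0 else v p.1 * v p.2

/-- The centered diagonal part of `v vᵀ`, as a vector. -/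
noncomputable def diagFeature {d : ℕ} (v : EuclideanSpace ℝ (Fin d)) :
    EuclideanSpace ℝ (Fin d) :=
  WithLp.toLp 2 fun a => v a ^ 2 - 1 / (d : ℝ)

lemma measurable_offDiagFeature {d : ℕ} : Measurable (offDiagFeature (d := d)) := by
  unfold offDiagFeature
  refine (WithLp.measurable_toLp 2 _).comp (measurable_pi_lambda _ fun p => ?_)
  split_ifs <;> fun_prop

lemma measurable_diagFeature {d : ℕ} : Measurable (diagFeature (d := d)) := by
  unfold diagFeature
  exact (WithLp.measurable_toLp 2 _).comp (measurable_pi_lambda _ fun p => by fun_prop)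

lemma norm_sq_offDiagFeature_le {d : ℕ} (v : EuclideanSpace ℝ (Fin d)) :
    ‖offDiagFeature v‖ ^ 2 ≤ (‖v‖ ^ 2) ^ 2 := by
  rw [EuclideanSpace.real_norm_sq_eq, EuclideanSpace.real_norm_sq_eq, pow_two (∑ i, _),
    Finset.sum_mul_sum, Fintype.sum_prod_type]
  refine Finset.sum_le_sum fun a _ => Finset.sum_le_sum fun b _ => ?_
  simp only [offDiagFeature]
  split_ifs
  · rw [zero_pow two_ne_zero]; positivity
  · rw [mul_pow]

lemma norm_sq_diagFeature_le {d : ℕ} (hd : 0 < d) (v : EuclideanSpace ℝ (Fin d)) :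
    ‖diagFeature v‖ ^ 2 ≤ (‖v‖ ^ 2) ^ 2 + 1 / d := by
  have hd' : (0 : ℝ) < d := by exact_mod_cast hd
  rw [EuclideanSpace.real_norm_sq_eq]
  calc ∑ a, (diagFeature v).ofLp a ^ 2 ≤ ∑ a, ((v a ^ 2) ^ 2 + (1 / (d : ℝ)) ^ 2) := by
        refine Finset.sum_le_sum fun a _ => ?_
        simp only [diagFeature]
        have : 0 ≤ v a ^ 2 * (1 / (d : ℝ)) := by positivity
        nlinarith
    _ = ∑ a, (v a ^ 2) ^ 2 + 1 / d := by
        rw [Finset.sum_add_distrib]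
        simp; field_simp
    _ ≤ _ := by
        gcongr
        rw [EuclideanSpace.real_norm_sq_eq]
        exact Finset.sum_sq_le_sq_sum_of_nonneg fun _ _ => sq_nonneg _

lemma Malpha_apply_eq_inner {d m : ℕ} (v : Fin m → EuclideanSpace ℝ (Fin d)) (i j : Fin m) :
    Malpha v i j =
      if i = j then 0 else inner ℝ (offDiagFeature (v i)) (offDiagFeature (v j)) := by
  simp only [Malpha, Matrix.of_apply]
  split_ifs
  · rfl
  · rw [PiLp.inner_apply, Fintype.sum_prod_type]
    refine Finset.sum_congr rfl fun a _ => Finset.sum_congr rfl fun b _ => ?_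
    simp only [offDiagFeature, RCLike.inner_apply, conj_trivial]
    split_ifs
    · simp
    · ring

lemma Mbeta_apply_eq_inner {d m : ℕ} (v : Fin m → EuclideanSpace ℝ (Fin d)) (i j : Fin m) :
    Mbeta v i j = if i = j then 0 else inner ℝ (diagFeature (v i)) (diagFeature (v j)) := by
  simp only [Mbeta, Matrix.of_apply]
  split_ifs
  · rfl
  · rw [PiLp.inner_apply]
    refine Finset.sum_congr rfl fun a _ => ?_
    simp only [diagFeature, RCLike.inner_apply, conj_trivial]
    ring

/-- Sub-exponential marginals: the bound on exponential moments used for both features. -/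
def HasSubexpMarginals {H : Type*} [NormedAddCommGroup H] [InnerProductSpace ℝ H]
    [MeasurableSpace H] (d : ℕ) (μ : Measure H) : Prop :=
  ∀ Y : H, ‖Y‖ ≤ d / 4 →
    ∫⁻ w, ENNReal.ofReal (Real.exp (inner ℝ w Y)) ∂μ ≤
      ENNReal.ofReal (Real.exp (2 * ‖Y‖ ^ 2 / d ^ 2))

/-- Pairing with Y is a quadratic form in v, whose matrix is the symmetrized Y with its diagonal
removed. Symmetrization does not increase the Frobenius norm, so the diagonalized moment bound
applies. -/
lemma hasSubexpMarginals_offDiagFeature {d : ℕ} (hd : 0 < d) :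
    HasSubexpMarginals d ((multivariateGaussian 0
      ((1 / (d : ℝ)) • (1 : Matrix (Fin d) (Fin d) ℝ))).map offDiagFeature) := by
  intro Y hY
  have hd' : (0 : ℝ) < d := by exact_mod_cast hd
  rw [lintegral_map (by fun_prop) measurable_offDiagFeature]
  set S : Matrix (Fin d) (Fin d) ℝ := Matrix.of fun a b =>
    if a = b then 0 else (Y (a, b) + Y (b, a)) / 2 with hSdef
  have hS : S.IsHermitian := by
    ext a b
    simp only [S, Matrix.conjTranspose_apply, Matrix.of_apply, star_trivial, eq_comm (a := b)]
    split_ifs <;> ring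
  have hsq : ∑ a, hS.eigenvalues a ^ 2 ≤ ‖Y‖ ^ 2 := by
    rw [sum_eigenvalues_sq, EuclideanSpace.real_norm_sq_eq, Fintype.sum_prod_type]
    calc ∑ a, ∑ b, S a b ^ 2 ≤ ∑ a, ∑ b, (Y (a, b) ^ 2 + Y (b, a) ^ 2) / 2 := by
          refine Finset.sum_le_sum fun a _ => Finset.sum_le_sum fun b _ => ?_
          simp only [S, Matrix.of_apply]
          split_ifs
          · rw [zero_pow two_ne_zero]; positivity
          · nlinarith [sq_nonneg (Y (a, b) - Y (b, a))]
      _ = (∑ a, ∑ b, Y (a, b) ^ 2 + ∑ a, ∑ b, Y (b, a) ^ 2) / 2 := by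
          simp_rw [← Finset.sum_div, Finset.sum_add_distrib]
      _ = _ := by
          rw [Finset.sum_comm (f := fun a b => Y (b, a) ^ 2)]; ring
  -- Trace zero makes the centering by 1/d free in the eigenbasis.
  have htr : ∑ a, hS.eigenvalues a = 0 := by
    have h := hS.trace_eq_sum_eigenvalues
    simp only [RCLike.ofReal_real_eq_id, id_eq] at h
    rw [← h]
    simp [Matrix.trace, S]
  have hq : ∀ v : EuclideanSpace ℝ (Fin d), inner ℝ (offDiagFeature v) Y =
      ∑ a, hS.eigenvalues a * ((inner ℝ (hS.eigenvectorBasis a) v) ^ 2 - 1 / d) := by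
    intro v
    simp_rw [mul_sub, Finset.sum_sub_distrib, ← Finset.sum_mul, htr, zero_mul, sub_zero]
    rw [sum_eigenvalues_mul_inner_sq, PiLp.inner_apply, Fintype.sum_prod_type]
    have e : ∀ a b : Fin d, S a b * (v a * v b) =
        (inner ℝ ((offDiagFeature v) (a, b)) (Y (a, b)) +
          inner ℝ ((offDiagFeature v) (b, a)) (Y (b, a))) / 2 := by
      intro a b
      simp only [S, Matrix.of_apply, offDiagFeature, RCLike.inner_apply, conj_trivial,
        eq_comm (a := b)]
      split_ifs <;> ring
    simp_rw [e, ← Finset.sum_div, Finset.sum_add_distrib]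
    rw [Finset.sum_comm (f := fun a b => inner ℝ ((offDiagFeature v) (b, a)) (Y (b, a)))]
    ring
  simp_rw [hq]
  refine (lintegral_exp_sum_sq_le hd hS.eigenvectorBasis hS.eigenvalues fun a => ?_).trans ?_
  · refine le_trans ?_ hY
    refine abs_le_of_sq_le_sq ?_ (norm_nonneg _)
    exact (Finset.single_le_sum (f := fun a => hS.eigenvalues a ^ 2)
      (fun _ _ => sq_nonneg _) (Finset.mem_univ a)).trans hsq
  · gcongr

lemma hasSubexpMarginals_diagFeature {d : ℕ} (hd : 0 < d) :
    HasSubexpMarginals d ((multivariateGaussian 0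
      ((1 / (d : ℝ)) • (1 : Matrix (Fin d) (Fin d) ℝ))).map diagFeature) := by
  intro Y hY
  rw [lintegral_map (by fun_prop) measurable_diagFeature]
  have hq : ∀ v : EuclideanSpace ℝ (Fin d), inner ℝ (diagFeature v) Y =
      ∑ a, Y a * ((inner ℝ (EuclideanSpace.basisFun (Fin d) ℝ a) v) ^ 2 - 1 / d) := by
    intro v
    simp [PiLp.inner_apply, diagFeature]
  simp_rw [hq]
  refine (lintegral_exp_sum_sq_le hd _ _ fun a => ?_).trans ?_
  · refine le_trans ?_ hY
    simpa using PiLp.norm_apply_le Y a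
  · rw [EuclideanSpace.real_norm_sq_eq]

/-- Tail bound for the squared norm. -/
lemma measure_norm_sq_sub_one_ge {d : ℕ} (hd : 0 < d) {θ s : ℝ} (hθ : 0 ≤ θ) (hθd : θ ≤ d / 4) :
    (multivariateGaussian 0 ((1 / (d : ℝ)) • (1 : Matrix (Fin d) (Fin d) ℝ)))
      {v | s ≤ |‖v‖ ^ 2 - 1|} ≤
      ENNReal.ofReal (2 * Real.exp (2 * θ ^ 2 / d - θ * s)) := by
  have hd' : (0 : ℝ) < d := by exact_mod_cast hd
  have key : ∀ η : ℝ, |η| = θ →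
      (multivariateGaussian 0 ((1 / (d : ℝ)) • (1 : Matrix (Fin d) (Fin d) ℝ)))
      {v | θ * s ≤ η * (‖v‖ ^ 2 - 1)} ≤ ENNReal.ofReal (Real.exp (2 * θ ^ 2 / d - θ * s)) := by
    intro η hη
    have h := lintegral_exp_sum_sq_le hd (EuclideanSpace.basisFun (Fin d) ℝ) (fun _ => η)
      (fun _ => hη.trans_le hθd)
    have e : ∀ v : EuclideanSpace ℝ (Fin d),
        ∑ a, η * ((inner ℝ (EuclideanSpace.basisFun (Fin d) ℝ a) v) ^ 2 - 1 / (d : ℝ)) =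
        η * (‖v‖ ^ 2 - 1) := by
      intro v
      rw [← Finset.mul_sum, Finset.sum_sub_distrib,
        (EuclideanSpace.basisFun (Fin d) ℝ).sum_sq_inner_right]
      simp [hd'.ne']
    simp_rw [e] at h
    have e2 : 2 * (∑ _a : Fin d, η ^ 2) / (d : ℝ) ^ 2 = 2 * θ ^ 2 / d := by
      rw [← hη, sq_abs]; simp; field_simp
    rw [e2] at h
    have hm := (mul_meas_ge_le_lintegral₀ (μ := multivariateGaussian 0
      ((1 / (d : ℝ)) • (1 : Matrix (Fin d) (Fin d) ℝ)))
      (f := fun v => ENNReal.ofReal (Real.exp (η * (‖v‖ ^ 2 - 1))))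
      (by fun_prop) (ENNReal.ofReal (Real.exp (θ * s)))).trans h
    have hset : {v : EuclideanSpace ℝ (Fin d) | θ * s ≤ η * (‖v‖ ^ 2 - 1)} =
        {v | ENNReal.ofReal (Real.exp (θ * s)) ≤
          ENNReal.ofReal (Real.exp (η * (‖v‖ ^ 2 - 1)))} := by
      ext v
      simp only [Set.mem_ofPred_eq]
      rw [ENNReal.ofReal_le_ofReal_iff (Real.exp_pos _).le, Real.exp_le_exp]
    rw [hset, Real.exp_sub, ENNReal.ofReal_div_of_pos (Real.exp_pos _),
      ENNReal.le_div_iff_mul_le (by simp [Real.exp_pos]) (by simp), mul_comm]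
    exact hm
  have hsub : {v : EuclideanSpace ℝ (Fin d) | s ≤ |‖v‖ ^ 2 - 1|} ⊆
      {v | θ * s ≤ θ * (‖v‖ ^ 2 - 1)} ∪ {v | θ * s ≤ (-θ) * (‖v‖ ^ 2 - 1)} := by
    intro v hv
    rcases le_abs.1 (show s ≤ |‖v‖ ^ 2 - 1| from hv) with h | h
    · left; exact mul_le_mul_of_nonneg_left h hθ
    · right
      have := mul_le_mul_of_nonneg_left h hθ
      simp only [Set.mem_ofPred_eq]; linarith
  refine (measure_mono hsub).trans ((measure_union_le _ _).trans ?_)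
  refine (add_le_add (key θ (abs_of_nonneg hθ)) (key (-θ) (by rw [abs_neg, abs_of_nonneg hθ]))).trans ?_
  rw [← ENNReal.ofReal_add (Real.exp_pos _).le (Real.exp_pos _).le]
  exact ENNReal.ofReal_le_ofReal (two_mul _).ge

/-! ### Decoupled bilinear forms -/

section bilinear
variable {H Ω : Type*} [NormedAddCommGroup H] [InnerProductSpace ℝ H] [MeasurableSpace H]
  [BorelSpace H] [SecondCountableTopology H] [MeasurableSpace Ω] {P : Measure Ω}
  {d m : ℕ} {w : Fin m → Ω → H}

lemma lintegral_exp_sum_inner_le (hw : ∀ i, Measurable (w i)) (hind : iIndepFun w P)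
    (hsub : ∀ i, HasSubexpMarginals d (P.map (w i))) (S : Finset (Fin m)) {x : Fin m → ℝ}
    (hx : ∀ i, |x i| ≤ d / 4) {u : H} (hu : ‖u‖ ≤ 1) :
    ∫⁻ ω, ENNReal.ofReal (Real.exp (∑ i ∈ S, x i * inner ℝ (w i ω) u)) ∂P ≤
      ENNReal.ofReal (Real.exp (2 * (∑ i ∈ S, x i ^ 2) / d ^ 2)) := by
  have hi : iIndepFun (fun i ω => ENNReal.ofReal (Real.exp (x i * inner ℝ (w i ω) u))) P :=
    hind.comp (fun i h => ENNReal.ofReal (Real.exp (x i * inner ℝ h u))) (fun i => by fun_prop)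
  have hp := lintegral_prod_eq_prod_lintegral_of_indepFun S _ hi
    (fun i => by have := hw i; fun_prop)
  have e : ∀ ω, ENNReal.ofReal (Real.exp (∑ i ∈ S, x i * inner ℝ (w i ω) u)) =
      ∏ i ∈ S, ENNReal.ofReal (Real.exp (x i * inner ℝ (w i ω) u)) := by
    intro ω
    rw [Real.exp_sum, ENNReal.ofReal_prod_of_nonneg (fun _ _ => (Real.exp_pos _).le)]
  simp_rw [e]
  rw [hp]
  calc _ ≤ ∏ i ∈ S, ENNReal.ofReal (Real.exp (2 * x i ^ 2 / d ^ 2)) := by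
        refine Finset.prod_le_prod' fun i _ => ?_
        have hn : ‖x i • u‖ ≤ |x i| := by
          rw [norm_smul, Real.norm_eq_abs]
          exact mul_le_of_le_one_right (abs_nonneg _) hu
        have h := hsub i (x i • u) (hn.trans (hx i))
        rw [lintegral_map (by fun_prop) (hw i)] at h
        simp_rw [inner_smul_right] at h
        refine h.trans (ENNReal.ofReal_le_ofReal (Real.exp_le_exp.2 ?_))
        have : ‖x i • u‖ ^ 2 ≤ x i ^ 2 := by
          rw [← sq_abs (x i)]; gcongr
        gcongr
    _ = _ := by
        rw [← ENNReal.ofReal_prod_of_nonneg (fun _ _ => (Real.exp_pos _).le), ← Real.exp_sum,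
          Finset.mul_sum, Finset.sum_div]

/-- Decoupled exponential moment bound: `x` and `y` have disjoint supports, and the linear
combination of the `w i` with coefficients `y` is normalized. -/
lemma lintegral_exp_bilinear_le [IsProbabilityMeasure P] (hw : ∀ i, Measurable (w i))
    (hind : iIndepFun w P) (hsub : ∀ i, HasSubexpMarginals d (P.map (w i))) {x y : Fin m → ℝ}
    (hx : ∀ i, |x i| ≤ d / 4) (hxy : ∀ i, x i * y i = 0) :
    ∫⁻ ω, ENNReal.ofReal (Real.exp (∑ i, x i * inner ℝ (w i ω)
        (‖∑ j, y j • w j ω‖⁻¹ • ∑ j, y j • w j ω))) ∂P ≤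
      ENNReal.ofReal (Real.exp (2 * (∑ i, x i ^ 2) / d ^ 2)) := by
  classical
  set S := Finset.univ.filter fun i => x i ≠ 0 with hS
  set T := Finset.univ.filter fun i => y i ≠ 0 with hT
  have hdis : Disjoint T S := by
    rw [Finset.disjoint_filter]
    intro i _ hy hx0
    exact (mul_ne_zero hx0 hy) (hxy i)
  have hI := hind.indepFun_finset T S hdis hw
  have hmT : Measurable fun ω (j : T) => w j ω := by fun_prop
  have hmS : Measurable fun ω (j : S) => w j ω := by fun_prop
  rw [indepFun_iff_map_prod_eq_prod_map_map hmT.aemeasurable hmS.aemeasurable] at hI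
  have hsT : ∀ ω, ∑ j, y j • w j ω = ∑ j : T, y j • w j ω := by
    intro ω
    rw [Finset.sum_coe_sort T (fun j => y j • w j ω), hT, Finset.sum_filter]
    refine Finset.sum_congr rfl fun j _ => ?_
    split_ifs with h
    · rfl
    · rw [not_not.1 h, zero_smul]
  have hsS : ∀ (ω : Ω) (u : H), ∑ i, x i * inner ℝ (w i ω) u =
      ∑ i : S, x i * inner ℝ (w i ω) u := by
    intro ω u
    rw [Finset.sum_coe_sort S (fun j => x j * inner ℝ (w j ω) u), hS, Finset.sum_filter]
    refine Finset.sum_congr rfl fun j _ => ?_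
    split_ifs with h
    · rfl
    · rw [not_not.1 h, zero_mul]
  simp_rw [hsT, hsS]
  set F : (T → H) × (S → H) → ENNReal := fun p => ENNReal.ofReal (Real.exp
    (∑ i : S, x i * inner ℝ (p.2 i) (‖∑ j : T, y j • p.1 j‖⁻¹ • ∑ j : T, y j • p.1 j))) with hF
  have hFm : Measurable F := by fun_prop
  have h1 : ∫⁻ ω, F ((fun j : T => w j ω), (fun i : S => w i ω)) ∂P =
      ∫⁻ q, ∫⁻ p, F (q, p) ∂(P.map fun ω (i : S) => w i ω) ∂(P.map fun ω (j : T) => w j ω) := by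
    rw [← lintegral_prod _ hFm.aemeasurable, ← hI, lintegral_map hFm (by fun_prop)]
  have := Measure.isProbabilityMeasure_map (μ := P) hmT.aemeasurable
  refine h1.trans_le ?_
  -- With the block on T frozen, the direction u is deterministic and independent of the block on S.
  -- If the combination vanishes, then u = 0, so only ‖u‖ ≤ 1 is claimed.
  calc _ ≤ ∫⁻ _q, ENNReal.ofReal (Real.exp (2 * (∑ i, x i ^ 2) / d ^ 2))
        ∂(P.map fun ω (j : T) => w j ω) := by
        refine lintegral_mono fun q => ?_
        rw [lintegral_map (by fun_prop) hmS]
        set u := ‖∑ j : T, y j • q j‖⁻¹ • ∑ j : T, y j • q j with hu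
        have hu1 : ‖u‖ ≤ 1 := by
          rw [hu, norm_smul, norm_inv, norm_norm]
          exact inv_mul_le_one
        have h2 := lintegral_exp_sum_inner_le hw hind hsub S hx hu1
        have e : ∀ ω, F (q, fun i : S => w i ω) =
            ENNReal.ofReal (Real.exp (∑ i ∈ S, x i * inner ℝ (w i ω) u)) := by
          intro ω
          rw [← Finset.sum_coe_sort S (fun i => x i * inner ℝ (w i ω) u)]
        simp_rw [e]
        refine h2.trans (ENNReal.ofReal_le_ofReal (Real.exp_le_exp.2 ?_))
        gcongr
        exact Finset.subset_univ _
    _ = _ := by simp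

/-- Tail bound for decoupled bilinear forms. -/
lemma measure_bilinear_gt_le [IsProbabilityMeasure P] (hw : ∀ i, Measurable (w i))
    (hind : iIndepFun w P) (hsub : ∀ i, HasSubexpMarginals d (P.map (w i))) {x y : Fin m → ℝ}
    (hx : ∀ i, |x i| ≤ d / 4) (hxy : ∀ i, x i * y i = 0) (t : ℝ) :
    P {ω | t * ‖∑ j, y j • w j ω‖ < inner ℝ (∑ i, x i • w i ω) (∑ j, y j • w j ω)} ≤
      ENNReal.ofReal (Real.exp (2 * (∑ i, x i ^ 2) / d ^ 2 - t)) := by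
  have h := lintegral_exp_bilinear_le hw hind hsub hx hxy
  have hm := (mul_meas_ge_le_lintegral₀ (μ := P)
      (f := fun ω => ENNReal.ofReal (Real.exp (∑ i, x i * inner ℝ (w i ω)
        (‖∑ j, y j • w j ω‖⁻¹ • ∑ j, y j • w j ω))))
      (by fun_prop) (ENNReal.ofReal (Real.exp t))).trans h
  rw [Real.exp_sub, ENNReal.ofReal_div_of_pos (Real.exp_pos _),
      ENNReal.le_div_iff_mul_le (by simp [Real.exp_pos]) (by simp), mul_comm]
  refine le_trans (mul_le_mul_right (measure_mono ?_) _) hm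
  intro ω hω
  simp only [Set.mem_ofPred_eq] at hω ⊢
  apply ENNReal.ofReal_le_ofReal
  rw [Real.exp_le_exp]
  set Y := ∑ j, y j • w j ω with hY
  -- The strict inequality defining the event excludes Y = 0, so division by ‖Y‖ is legitimate.
  have hpos : 0 < ‖Y‖ := by
    rw [norm_pos_iff]
    intro h0
    rw [h0] at hω
    simp at hω
  have e : ∑ i, x i * inner ℝ (w i ω) (‖Y‖⁻¹ • Y) =
      ‖Y‖⁻¹ * inner ℝ (∑ i, x i • w i ω) Y := by
    rw [sum_inner, Finset.mul_sum]
    refine Finset.sum_congr rfl fun i _ => ?_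
    rw [inner_smul_right, real_inner_smul_left]; ring
  rw [e, ← div_eq_inv_mul, le_div_iff₀ hpos]
  exact hω.le

end bilinear

/-! ### Dyadic vectors and their entropy -/

/-- The values `0` and `± 2 ^ l` for `k ≤ l ≤ N`. -/
noncomputable def dyadicValues (k N : ℕ) : Finset ℝ :=
  insert 0 ((Finset.Icc k N).image (fun l => (2 : ℝ) ^ l) ∪
    (Finset.Icc k N).image (fun l => -(2 : ℝ) ^ l))

lemma mem_dyadicValues {k N : ℕ} {v : ℝ} :
    v ∈ dyadicValues k N ↔ v = 0 ∨ ∃ l, k ≤ l ∧ l ≤ N ∧ |v| = 2 ^ l := by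
  simp only [dyadicValues, Finset.mem_insert, Finset.mem_union, Finset.mem_image, Finset.mem_Icc]
  refine or_congr_right ⟨?_, ?_⟩
  · rintro (⟨l, ⟨h1, h2⟩, rfl⟩ | ⟨l, ⟨h1, h2⟩, rfl⟩)
    · exact ⟨l, h1, h2, abs_of_pos (by positivity)⟩
    · exact ⟨l, h1, h2, by rw [abs_neg, abs_of_pos (by positivity)]⟩
  · rintro ⟨l, h1, h2, h⟩
    rcases abs_eq (by positivity) |>.1 h with h | h
    · exact Or.inl ⟨l, ⟨h1, h2⟩, h.symm⟩
    · exact Or.inr ⟨l, ⟨h1, h2⟩, h.symm⟩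

/-- The entropy scale of vectors at dyadic level `k`. -/
noncomputable def levelEntropy (n : ℝ) (k : ℕ) : ℝ := n * ((k + 1) / 4 ^ k)

lemma antitone_levelEntropy {n : ℝ} (hn : 0 ≤ n) : Antitone (levelEntropy n) := by
  refine antitone_nat_of_succ_le fun k => mul_le_mul_of_nonneg_left ?_ hn
  rw [div_le_div_iff₀ (by positivity) (by positivity)]
  push_cast
  have h : (0 : ℝ) < 4 ^ k := by positivity
  rw [pow_succ]
  nlinarith [mul_nonneg (Nat.cast_nonneg (α := ℝ) k) h.le]

lemma levelEntropy_nonneg {n : ℝ} (hn : 0 ≤ n) (k : ℕ) : 0 ≤ levelEntropy n k := by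
  unfold levelEntropy; positivity

/-- The value 0 contributes 1. At level l = k + j the exponent is -2(k+1)4^j ≤ -2(l+1), so the
nonzero levels form a geometric series starting at order 4^(-k). -/
lemma sum_dyadicValues_exp_le (k N : ℕ) :
    ∑ v ∈ dyadicValues k N, Real.exp (-(2 * (k + 1) / 4 ^ k) * v ^ 2) ≤ 1 + 1 / 4 ^ k := by
  set f : ℝ → ℝ := fun v => Real.exp (-(2 * (k + 1) / 4 ^ k) * v ^ 2) with hf
  have hterm : ∀ l ∈ Finset.Icc k N, f (2 ^ l) ≤ 1 / 4 * (1 / 4) ^ l := by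
    intro l hl
    obtain ⟨j, rfl⟩ := Nat.exists_eq_add_of_le (Finset.mem_Icc.1 hl).1
    have h4 : Real.exp (-2) ≤ 1 / 4 := by
      have h1 : (2 : ℝ) ≤ Real.exp 1 := by linarith [Real.add_one_le_exp (1 : ℝ)]
      have h2 : Real.exp 1 * Real.exp 1 * Real.exp (-2) = 1 := by
        rw [← Real.exp_add, ← Real.exp_add]; norm_num
      nlinarith [Real.exp_pos (-2), mul_le_mul h1 h1 (by norm_num) (by linarith)]
    calc f (2 ^ (k + j)) ≤ Real.exp ((k + j + 1 : ℕ) * (-2)) := by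
          simp only [hf]
          rw [Real.exp_le_exp]
          have e : ((2 : ℝ) ^ (k + j)) ^ 2 = 4 ^ k * 4 ^ j := by
            rw [← pow_mul, mul_comm, pow_mul, pow_add]; norm_num
          rw [e]
          have e2 : -(2 * ((k : ℝ) + 1) / 4 ^ k) * (4 ^ k * 4 ^ j) = -(2 * (k + 1)) * 4 ^ j := by
            field_simp
          rw [e2]
          have h5 : (1 : ℝ) + j ≤ 4 ^ j := by
            have := one_add_mul_le_pow (a := (3 : ℝ)) (by norm_num) j
            norm_num at this
            nlinarith [Nat.cast_nonneg (α := ℝ) j]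
          push_cast
          nlinarith [Nat.cast_nonneg (α := ℝ) j, Nat.cast_nonneg (α := ℝ) k,
            mul_nonneg (Nat.cast_nonneg (α := ℝ) k) (Nat.cast_nonneg (α := ℝ) j),
            mul_le_mul_of_nonneg_left h5 (by positivity : (0 : ℝ) ≤ k + 1)]
      _ = Real.exp (-2) ^ (k + j + 1) := by rw [Real.exp_nat_mul]
      _ ≤ (1 / 4) ^ (k + j + 1) := by gcongr
      _ = _ := by rw [pow_succ']
  have hgeo : ∑ l ∈ Finset.Icc k N, f (2 ^ l) ≤ 1 / 3 * (1 / 4) ^ k := by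
    calc _ ≤ ∑ l ∈ Finset.Icc k N, 1 / 4 * (1 / 4 : ℝ) ^ l := Finset.sum_le_sum hterm
      _ = 1 / 4 * ∑ l ∈ Finset.Ico k (N + 1), (1 / 4 : ℝ) ^ l := by
          rw [← Finset.mul_sum]; rfl
      _ ≤ 1 / 4 * ((1 / 4) ^ k / (1 - 1 / 4)) := by
          gcongr
          exact geom_sum_Ico_le_of_lt_one (by norm_num) (by norm_num)
      _ = _ := by ring
  have hpos : ∀ v, 0 ≤ f v := fun v => (Real.exp_pos _).le
  have h1 : ∑ v ∈ (Finset.Icc k N).image (fun l => (2 : ℝ) ^ l), f v ≤ 1 / 3 * (1 / 4) ^ k :=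
    (Finset.sum_image_le_of_nonneg fun _ _ => hpos _).trans hgeo
  have h2 : ∑ v ∈ (Finset.Icc k N).image (fun l => -(2 : ℝ) ^ l), f v ≤ 1 / 3 * (1 / 4) ^ k := by
    refine (Finset.sum_image_le_of_nonneg fun _ _ => hpos _).trans ?_
    have : ∀ v, f (-v) = f v := fun v => by simp [hf]
    simpa only [this] using hgeo
  calc ∑ v ∈ dyadicValues k N, f v ≤ f 0 + ∑ v ∈ ((Finset.Icc k N).image (fun l => (2 : ℝ) ^ l) ∪
        (Finset.Icc k N).image (fun l => -(2 : ℝ) ^ l)), f v := by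
        unfold dyadicValues
        by_cases h : (0 : ℝ) ∈ ((Finset.Icc k N).image (fun l => (2 : ℝ) ^ l) ∪
          (Finset.Icc k N).image (fun l => -(2 : ℝ) ^ l))
        · rw [Finset.insert_eq_of_mem h]; linarith [hpos 0]
        · rw [Finset.sum_insert h]
    _ ≤ 1 + (1 / 3 * (1 / 4) ^ k + 1 / 3 * (1 / 4) ^ k) := by
        gcongr
        · simp [hf]
        · have := Finset.sum_union_inter (s₁ := (Finset.Icc k N).image (fun l => (2 : ℝ) ^ l))
            (s₂ := (Finset.Icc k N).image (fun l => -(2 : ℝ) ^ l)) (f := f)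
          have h0 : 0 ≤ ∑ v ∈ ((Finset.Icc k N).image (fun l => (2 : ℝ) ^ l)) ∩
            (Finset.Icc k N).image (fun l => -(2 : ℝ) ^ l), f v :=
            Finset.sum_nonneg fun _ _ => hpos _
          linarith
    _ ≤ _ := by
        rw [one_div_pow]
        have : (0 : ℝ) < 1 / 4 ^ k := by positivity
        linarith

/-- Vectors with dyadic entries at levels `k, …, N` and squared norm at most `5 n`. -/
noncomputable def dyadicVectors (m k N : ℕ) (n : ℝ) : Finset (Fin m → ℝ) :=
  (Fintype.piFinset fun _ => dyadicValues k N).filter fun y => ∑ i, y i ^ 2 ≤ 5 * n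

lemma mem_dyadicVectors {m k N : ℕ} {n : ℝ} {y : Fin m → ℝ} :
    y ∈ dyadicVectors m k N n ↔ (∀ i, y i ∈ dyadicValues k N) ∧ ∑ i, y i ^ 2 ≤ 5 * n := by
  simp [dyadicVectors]

/-- Counting by an exponential weight: each vector has weight exp(κ(5n - Σ y_i²)) ≥ 1, and the total
weight factorizes over coordinates. With κ = 2(k+1)/4^k the prefactor costs 10 entropies and the
product at most one more. The top level N does not enter. -/
lemma card_dyadicVectors_le {m k N : ℕ} {n : ℝ} (hm : (m : ℝ) ≤ n) :
    ((dyadicVectors m k N n).card : ℝ) ≤ Real.exp (11 * levelEntropy n k) := by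
  have hn : 0 ≤ n := (Nat.cast_nonneg m).trans hm
  set κ : ℝ := 2 * (k + 1) / 4 ^ k with hκ
  have hκ0 : 0 ≤ κ := by positivity
  calc ((dyadicVectors m k N n).card : ℝ) = ∑ y ∈ dyadicVectors m k N n, (1 : ℝ) := by simp
    _ ≤ ∑ y ∈ dyadicVectors m k N n, Real.exp (κ * (5 * n)) * ∏ i, Real.exp (-κ * y i ^ 2) := by
        refine Finset.sum_le_sum fun y hy => ?_
        rw [← Real.exp_sum, ← Real.exp_add, ← Finset.mul_sum]
        apply Real.one_le_exp
        nlinarith [mul_le_mul_of_nonneg_left (mem_dyadicVectors.1 hy).2 hκ0]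
    _ ≤ ∑ y ∈ Fintype.piFinset fun _ : Fin m => dyadicValues k N,
        Real.exp (κ * (5 * n)) * ∏ i, Real.exp (-κ * y i ^ 2) := by
        refine Finset.sum_le_sum_of_subset_of_nonneg (Finset.filter_subset _ _) fun _ _ _ => ?_
        positivity
    _ = Real.exp (κ * (5 * n)) * (∑ v ∈ dyadicValues k N, Real.exp (-κ * v ^ 2)) ^ m := by
        rw [← Finset.mul_sum, Finset.sum_prod_piFinset _ (fun _ v => Real.exp (-κ * v ^ 2))]
        simp
    _ ≤ Real.exp (κ * (5 * n)) * Real.exp (1 / 4 ^ k) ^ m := by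
        gcongr
        refine (sum_dyadicValues_exp_le k N).trans ?_
        rw [add_comm]
        exact Real.add_one_le_exp _
    _ ≤ _ := by
        rw [← Real.exp_nat_mul, ← Real.exp_add, Real.exp_le_exp, levelEntropy]
        have h1 : (m : ℝ) * (1 / 4 ^ k) ≤ n * ((k + 1) / 4 ^ k) := by
          gcongr
          linarith [Nat.cast_nonneg (α := ℝ) k]
        have h2 : κ * (5 * n) = 10 * (n * ((k + 1) / 4 ^ k)) := by rw [hκ]; ring
        linarith

/-! ### The probability that all level bounds hold -/

section event
variable {H Ω : Type*} [NormedAddCommGroup H] [InnerProductSpace ℝ H]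
  {d m : ℕ}

/-- The decoupled bilinear form of the family `w` is controlled at every dyadic level. -/
def LevelBounds (d N : ℕ) (n : ℝ) (w : Fin m → H) : Prop :=
  ∀ k ≤ N, ∀ x ∈ dyadicVectors m k k n, ∀ y ∈ dyadicVectors m k N n, (∀ i, x i * y i = 0) →
    inner ℝ (∑ i, x i • w i) (∑ j, y j • w j) ≤
      2 ^ k * (120 / d) * levelEntropy n k * ‖∑ j, y j • w j‖

variable [MeasurableSpace H] [BorelSpace H] [SecondCountableTopology H] [MeasurableSpace Ω]
  {P : Measure Ω} [IsProbabilityMeasure P] {w : Fin m → Ω → H}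

/-- Both factors have at most exp(11 E) candidates, where E is the entropy at level k, and each pair
fails with probability at most exp(-29 E). The union bound leaves exp(-7 E) per level. -/
lemma measure_not_levelBounds_le (hd : 0 < d) {N : ℕ} {n : ℝ} (hm : (m : ℝ) ≤ n)
    (hN : (4 : ℝ) ^ N ≤ 5 * n) (hw : ∀ i, Measurable (w i)) (hind : iIndepFun w P)
    (hsub : ∀ i, HasSubexpMarginals d (P.map (w i))) :
    P {ω | ¬ LevelBounds d N n fun i => w i ω} ≤
      ENNReal.ofReal ((N + 1) * Real.exp (-(N + 1))) := by
  have hn : 0 ≤ n := (Nat.cast_nonneg m).trans hm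
  have hd' : (0 : ℝ) < d := by exact_mod_cast hd
  have hpair : ∀ k ≤ N, ∀ x ∈ dyadicVectors m k k n, ∀ y ∈ dyadicVectors m k N n,
      P {ω | (∀ i, x i * y i = 0) ∧ 2 ^ k * (120 / d) * levelEntropy n k * ‖∑ j, y j • w j ω‖ <
        inner ℝ (∑ i, x i • w i ω) (∑ j, y j • w j ω)} ≤
      ENNReal.ofReal (Real.exp (-(29 * levelEntropy n k))) := by
    intro k _ x hx y hy
    obtain ⟨hx1, hx2⟩ := mem_dyadicVectors.1 hx
    by_cases hxy : ∀ i, x i * y i = 0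
    swap
    · simp only [hxy, false_and]
      simp
    -- The largest scaling that keeps entries of size 2^k within the range d/4 of the moment bound.
    set s : ℝ := d / 4 / 2 ^ k with hs
    have hs0 : 0 < s := by positivity
    have h := measure_bilinear_gt_le (x := fun i => s * x i) (y := y) hw hind hsub (fun i => by
      rcases mem_dyadicValues.1 (hx1 i) with h | ⟨l, h1, h2, h3⟩
      · rw [h]; simp; positivity
      · obtain rfl := le_antisymm h2 h1
        rw [abs_mul, h3, abs_of_pos hs0, hs]
        apply le_of_eq; field_simp) (fun i => by rw [mul_assoc, hxy i, mul_zero])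
        (30 * levelEntropy n k)
    refine le_trans (measure_mono ?_) (h.trans (ENNReal.ofReal_le_ofReal (Real.exp_le_exp.2 ?_)))
    · rintro ω ⟨_, hω⟩
      simp only [Set.mem_ofPred_eq]
      have e : ∑ i, (s * x i) • w i ω = s • ∑ i, x i • w i ω := by
        rw [Finset.smul_sum]; simp_rw [mul_smul]
      rw [e, real_inner_smul_left]
      refine lt_of_le_of_lt (le_of_eq ?_) (mul_lt_mul_of_pos_left hω hs0)
      rw [hs]; field_simp; ring
    -- The variance term is at most 5/8 of the entropy, so the threshold 30 still leaves 29.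
    · simp_rw [mul_pow, ← Finset.mul_sum]
      have e4 : ((2 : ℝ) ^ k) ^ 2 = 4 ^ k := by rw [← pow_mul, mul_comm, pow_mul]; norm_num
      have e : 2 * (s ^ 2 * ∑ i, x i ^ 2) / (d : ℝ) ^ 2 = 1 / 8 * ((∑ i, x i ^ 2) / 4 ^ k) := by
        rw [hs, div_pow, e4]; field_simp; ring
      rw [e]
      have : (∑ i, x i ^ 2) / 4 ^ k ≤ 5 * levelEntropy n k := by
        rw [levelEntropy, ← mul_div_assoc, ← mul_div_assoc]
        gcongr
        nlinarith [mul_nonneg hn (Nat.cast_nonneg (α := ℝ) k)]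
      linarith [levelEntropy_nonneg hn k]
  have hk : ∀ k ∈ Finset.range (N + 1),
      ∑ x ∈ dyadicVectors m k k n, ∑ y ∈ dyadicVectors m k N n,
        ENNReal.ofReal (Real.exp (-(29 * levelEntropy n k))) ≤
      ENNReal.ofReal (Real.exp (-(N + 1))) := by
    intro k hk
    have hkN : k ≤ N := by simpa [Nat.lt_succ_iff] using hk
    rw [Finset.sum_const, Finset.sum_const, smul_smul, nsmul_eq_mul,
      ← ENNReal.ofReal_natCast, ← ENNReal.ofReal_mul (by positivity)]
    apply ENNReal.ofReal_le_ofReal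
    push_cast
    calc _ ≤ Real.exp (11 * levelEntropy n k) * Real.exp (11 * levelEntropy n k) *
          Real.exp (-(29 * levelEntropy n k)) := by
          gcongr
          · exact card_dyadicVectors_le hm
          · exact card_dyadicVectors_le hm
      _ = Real.exp (-(7 * levelEntropy n k)) := by
          rw [← Real.exp_add, ← Real.exp_add]; congr 1; ring
      _ ≤ _ := by
          rw [Real.exp_le_exp]
          have h1 := antitone_levelEntropy hn hkN
          -- The top level has the least entropy, and 4^N ≤ 5n keeps it at least (N+1)/5; the factor
          -- 7 then covers the 5.
          have h2 : ((N : ℝ) + 1) / 5 ≤ levelEntropy n N := by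
            rw [levelEntropy, ← mul_div_assoc, div_le_div_iff₀ (by norm_num) (by positivity)]
            nlinarith [mul_le_mul_of_nonneg_left hN (by positivity : (0 : ℝ) ≤ N + 1)]
          have : (0 : ℝ) ≤ N := Nat.cast_nonneg N
          linarith
  calc P {ω | ¬ LevelBounds d N n fun i => w i ω} ≤
      P (⋃ k ∈ Finset.range (N + 1), ⋃ x ∈ dyadicVectors m k k n, ⋃ y ∈ dyadicVectors m k N n,
        {ω | (∀ i, x i * y i = 0) ∧ 2 ^ k * (120 / d) * levelEntropy n k * ‖∑ j, y j • w j ω‖ <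
        inner ℝ (∑ i, x i • w i ω) (∑ j, y j • w j ω)}) := by
        refine measure_mono fun ω hω => ?_
        simp only [Set.mem_ofPred_eq, LevelBounds] at hω
        push Not at hω
        obtain ⟨k, hk, x, hx, y, hy, h1, h2⟩ := hω
        simp only [Set.mem_iUnion]
        exact ⟨k, Finset.mem_range.2 (Nat.lt_succ_of_le hk), x, hx, y, hy, h1, h2⟩
    _ ≤ ∑ k ∈ Finset.range (N + 1), ∑ x ∈ dyadicVectors m k k n, ∑ y ∈ dyadicVectors m k N n,
        ENNReal.ofReal (Real.exp (-(29 * levelEntropy n k))) := by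
        refine (measure_biUnion_finset_le _ _).trans (Finset.sum_le_sum fun k hk => ?_)
        refine (measure_biUnion_finset_le _ _).trans (Finset.sum_le_sum fun x hx => ?_)
        refine (measure_biUnion_finset_le _ _).trans (Finset.sum_le_sum fun y hy => ?_)
        exact hpair k (Nat.lt_succ_iff.1 (Finset.mem_range.1 hk)) x hx y hy
    _ ≤ ∑ k ∈ Finset.range (N + 1), ENNReal.ofReal (Real.exp (-(N + 1))) := Finset.sum_le_sum hk
    _ = _ := by
        rw [Finset.sum_const, nsmul_eq_mul, Finset.card_range,
          ENNReal.ofReal_mul (by positivity), ← ENNReal.ofReal_natCast]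
        push_cast; rfl

end event

/-! ### Rounding and decoupling through vertices of boxes -/

section vertex

/-- A function that is affine in each coordinate is maximized over a box at a vertex. -/
lemma exists_vertex_le {ι : Type*} [Fintype ι] [DecidableEq ι] {f : (ι → ℝ) → ℝ}
    (hf : ∀ i z, ∃ a b : ℝ, ∀ t, f (Function.update z i t) = a + b * t) {z lo hi : ι → ℝ}
    (hlo : ∀ i, lo i ≤ z i) (hhi : ∀ i, z i ≤ hi i) :
    ∃ ξ : ι → ℝ, (∀ i, ξ i = lo i ∨ ξ i = hi i) ∧ f z ≤ f ξ := by
  suffices h : ∀ s : Finset ι, ∃ ξ : ι → ℝ, (∀ i ∈ s, ξ i = lo i ∨ ξ i = hi i) ∧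
      (∀ i ∉ s, ξ i = z i) ∧ f z ≤ f ξ by
    obtain ⟨ξ, h1, -, h2⟩ := h Finset.univ
    exact ⟨ξ, fun i => h1 i (Finset.mem_univ i), h2⟩
  intro s
  induction s using Finset.induction_on with
  | empty => exact ⟨z, by simp, by simp, le_rfl⟩
  | insert i s his ih =>
    obtain ⟨ξ, h1, h2, h3⟩ := ih
    obtain ⟨a, b, hab⟩ := hf i ξ
    have key : ∀ t, (t = lo i ∨ t = hi i) → f ξ ≤ f (Function.update ξ i t) →
        ∃ ξ' : ι → ℝ, (∀ j ∈ insert i s, ξ' j = lo j ∨ ξ' j = hi j) ∧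
          (∀ j ∉ insert i s, ξ' j = z j) ∧ f z ≤ f ξ' := by
      intro t ht hle
      refine ⟨Function.update ξ i t, fun j hj => ?_, fun j hj => ?_, h3.trans hle⟩
      · rcases eq_or_ne j i with rfl | hne
        · simpa using ht
        · rw [Function.update_of_ne hne]
          exact h1 j (Finset.mem_of_mem_insert_of_ne hj hne)
      · rw [Finset.mem_insert, not_or] at hj
        rw [Function.update_of_ne hj.1]
        exact h2 j hj.2
    have hself : f ξ = a + b * z i := by
      rw [← hab, ← h2 i his, Function.update_eq_self]
    rcases le_total 0 b with hb | hb
    · refine key (hi i) (Or.inr rfl) ?_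
      rw [hself, hab]
      nlinarith [hhi i]
    · refine key (lo i) (Or.inl rfl) ?_
      rw [hself, hab]
      nlinarith [hlo i]

/-- The only term quadratic in one coordinate sits on the diagonal, which vanishes. The pair (c, e)
is (1, -1) for decoupling and (0, 1) for rounding. -/
lemma exists_affine_update_sum {ι : Type*} [Fintype ι] [DecidableEq ι] {A : ι → ι → ℝ}
    (hA : ∀ i, A i i = 0) (c e : ℝ) (i : ι) (z : ι → ℝ) :
    ∃ a b : ℝ, ∀ t, ∑ j, ∑ k, A j k * (Function.update z i t j * (c + e * Function.update z i t k))
      = a + b * t := by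
  have h : ∀ j k, ∃ a b : ℝ, ∀ t,
      A j k * (Function.update z i t j * (c + e * Function.update z i t k)) = a + b * t := by
    intro j k
    rcases eq_or_ne j i with rfl | hj
    · rcases eq_or_ne k j with rfl | hk
      · exact ⟨0, 0, fun t => by simp [hA]⟩
      · refine ⟨0, A j k * (c + e * z k), fun t => ?_⟩
        rw [Function.update_self, Function.update_of_ne hk]; ring
    · rcases eq_or_ne k i with rfl | hk
      · refine ⟨A j k * z j * c, A j k * z j * e, fun t => ?_⟩
        rw [Function.update_self, Function.update_of_ne hj]; ring
      · refine ⟨A j k * (z j * (c + e * z k)), 0, fun t => ?_⟩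
        rw [Function.update_of_ne hj, Function.update_of_ne hk]; ring
  choose a b hab using h
  refine ⟨∑ j, ∑ k, a j k, ∑ j, ∑ k, b j k, fun t => ?_⟩
  simp_rw [hab, Finset.sum_add_distrib, Finset.sum_mul]

/-- Decoupling of an off-diagonal quadratic form. -/
lemma exists_decoupling {ι : Type*} [Fintype ι] [DecidableEq ι] {A : ι → ι → ℝ}
    (hA : ∀ i, A i i = 0) :
    ∃ p : ι → ℝ, (∀ i, p i = 0 ∨ p i = 1) ∧
      ∑ i, ∑ j, A i j ≤ 4 * ∑ i, ∑ j, A i j * (p i * (1 - p j)) := by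
  obtain ⟨p, h1, h2⟩ := exists_vertex_le (ι := ι)
    (f := fun z => ∑ i, ∑ j, A i j * (z i * (1 + (-1) * z j)))
    (exists_affine_update_sum hA 1 (-1)) (z := fun _ => 1 / 2) (lo := fun _ => 0) (hi := fun _ => 1)
    (fun _ => by norm_num) (fun _ => by norm_num)
  refine ⟨p, h1, ?_⟩
  -- At the centre of the cube every off-diagonal weight p_i(1 - p_j) is 1/4, the source of the
  -- factor 4.
  have e : ∑ i, ∑ j, A i j * ((1 / 2 : ℝ) * (1 + (-1) * (1 / 2))) = (∑ i, ∑ j, A i j) / 4 := by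
    simp_rw [← Finset.sum_mul]; ring
  simp only at h2
  rw [e] at h2
  have e2 : ∀ i j, A i j * (p i * (1 - p j)) = A i j * (p i * (1 + (-1) * p j)) :=
    fun i j => by ring
  simp_rw [e2]
  linarith

/-- Below 1 the bracket is [0, 1]; above 1 it consists of consecutive powers of 2. The additive 1
sums to m ≤ n and the factor 4 to 4n, hence the bound 5n on rounded vectors. -/
lemma exists_dyadic_bracket_of_nonneg {t : ℝ} (ht : 0 ≤ t) :
    ∃ lo hi : ℝ, lo ≤ t ∧ t ≤ hi ∧ (lo = 0 ∨ ∃ l : ℕ, |lo| = 2 ^ l) ∧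
      (hi = 0 ∨ ∃ l : ℕ, |hi| = 2 ^ l) ∧ lo ^ 2 ≤ 1 + 4 * t ^ 2 ∧ hi ^ 2 ≤ 1 + 4 * t ^ 2 := by
  rcases le_total t 1 with h1 | h1
  · exact ⟨0, 1, ht, h1, Or.inl rfl, Or.inr ⟨0, by simp⟩,
      by rw [zero_pow two_ne_zero]; positivity, by nlinarith⟩
  · obtain ⟨l, h2, h3⟩ := exists_nat_pow_near h1 one_lt_two
    have hp : (0 : ℝ) < 2 ^ l := by positivity
    refine ⟨2 ^ l, 2 ^ (l + 1), h2, h3.le, Or.inr ⟨l, abs_of_pos hp⟩,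
      Or.inr ⟨l + 1, abs_of_pos (by positivity)⟩, ?_, ?_⟩
    · nlinarith
    · rw [pow_succ (2 : ℝ) l, mul_pow]; nlinarith

lemma exists_dyadic_bracket (t : ℝ) :
    ∃ lo hi : ℝ, lo ≤ t ∧ t ≤ hi ∧ (lo = 0 ∨ ∃ l : ℕ, |lo| = 2 ^ l) ∧
      (hi = 0 ∨ ∃ l : ℕ, |hi| = 2 ^ l) ∧ lo ^ 2 ≤ 1 + 4 * t ^ 2 ∧ hi ^ 2 ≤ 1 + 4 * t ^ 2 := by
  rcases le_total 0 t with ht | ht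
  · exact exists_dyadic_bracket_of_nonneg ht
  · obtain ⟨lo, hi, h1, h2, h3, h4, h5, h6⟩ :=
      exists_dyadic_bracket_of_nonneg (t := -t) (by linarith)
    rw [neg_sq] at h5 h6
    exact ⟨-hi, -lo, by linarith, by linarith, by simpa using h4, by simpa using h3,
      by rwa [neg_sq], by rwa [neg_sq]⟩

/-- Rounding of an off-diagonal quadratic form to dyadic vectors. -/
lemma exists_dyadicVectors_le {m N : ℕ} {n : ℝ} (hm : (m : ℝ) ≤ n) (hN : 5 * n < 4 ^ (N + 1))
    {A : Fin m → Fin m → ℝ} (hA : ∀ i, A i i = 0) {z : Fin m → ℝ} (hz : ∑ i, z i ^ 2 ≤ n) :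
    ∃ ξ ∈ dyadicVectors m 0 N n,
      ∑ i, ∑ j, A i j * (z i * z j) ≤ ∑ i, ∑ j, A i j * (ξ i * ξ j) := by
  choose lo hi h1 h2 h3 h4 h5 h6 using fun i => exists_dyadic_bracket (z i)
  obtain ⟨ξ, hξ, hle⟩ := exists_vertex_le
    (f := fun z => ∑ i, ∑ j, A i j * (z i * (0 + 1 * z j)))
    (exists_affine_update_sum hA 0 1) h1 h2
  simp only [zero_add, one_mul] at hle
  refine ⟨ξ, mem_dyadicVectors.2 ?_, hle⟩
  have hsq : ∀ i, ξ i ^ 2 ≤ 1 + 4 * z i ^ 2 := fun i => by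
    rcases hξ i with h | h <;> rw [h]
    exacts [h5 i, h6 i]
  have hsum : ∑ i, ξ i ^ 2 ≤ 5 * n := by
    calc ∑ i, ξ i ^ 2 ≤ ∑ i, (1 + 4 * z i ^ 2) := Finset.sum_le_sum fun i _ => hsq i
      _ = m + 4 * ∑ i, z i ^ 2 := by
        rw [Finset.sum_add_distrib, ← Finset.mul_sum]; simp
      _ ≤ _ := by linarith
  refine ⟨fun i => mem_dyadicValues.2 ?_, hsum⟩
  have hd : ξ i = 0 ∨ ∃ l : ℕ, |ξ i| = 2 ^ l := by
    rcases hξ i with h | h <;> rw [h]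
    exacts [h3 i, h4 i]
  refine hd.imp_right ?_
  rintro ⟨l, hl⟩
  refine ⟨l, Nat.zero_le _, ?_, hl⟩
  have h7 : (4 : ℝ) ^ l = ξ i ^ 2 := by
    rw [← sq_abs, hl, ← pow_mul, mul_comm, pow_mul]; norm_num
  have h8 : (4 : ℝ) ^ l < 4 ^ (N + 1) := by
    rw [h7]
    exact ((Finset.single_le_sum (f := fun i => ξ i ^ 2) (fun _ _ => sq_nonneg _)
      (Finset.mem_univ i)).trans hsum).trans_lt hN
  exact Nat.lt_succ_iff.1 ((pow_lt_pow_iff_right₀ (by norm_num)).1 h8)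

end vertex

/-! ### Summation over dyadic levels -/

section levels

/-- Each product is charged to the smaller of its two levels. The weak inequality in one term and
the strict one in the other ensure that equal levels count once. -/
lemma mul_eq_sum_levels {N : ℕ} {u v : ℝ} (hu : u ∈ dyadicValues 0 N) (hv : v ∈ dyadicValues 0 N) :
    u * v = ∑ k ∈ Finset.range (N + 1),
      ((if |u| = 2 ^ k then u else 0) * (if 2 ^ k ≤ |v| then v else 0) +
        (if |v| = 2 ^ k then v else 0) * (if 2 ^ k < |u| then u else 0)) := by
  rcases mem_dyadicValues.1 hu with rfl | ⟨a, -, ha, hau⟩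
  · simp
  rcases mem_dyadicValues.1 hv with rfl | ⟨b, -, hb, hbv⟩
  · simp
  have hinj : ∀ a k : ℕ, ((2 : ℝ) ^ a = 2 ^ k ↔ a = k) := fun a k =>
    pow_right_inj₀ (by norm_num) (by norm_num)
  simp_rw [hau, hbv, hinj, Finset.sum_add_distrib, ite_mul, zero_mul]
  rw [Finset.sum_ite_eq, Finset.sum_ite_eq, if_pos (Finset.mem_range.2 (by omega)),
    if_pos (Finset.mem_range.2 (by omega))]
  rcases le_or_gt ((2 : ℝ) ^ a) (2 ^ b) with h | h
  · rw [if_pos h, if_neg (not_lt.2 h)]; ring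
  · rw [if_neg (not_le.2 h), if_pos h]; ring

lemma sum_range_add_one_div_two_pow_le (K : ℕ) :
    ∑ k ∈ Finset.range K, ((k : ℝ) + 1) / 2 ^ k ≤ 4 := by
  have h : ∑ k ∈ Finset.range K, ((k : ℝ) + 1) / 2 ^ k = 4 - (2 * K + 4) / 2 ^ K := by
    induction K with
    | zero => norm_num
    | succ K ih =>
      rw [Finset.sum_range_succ, ih, pow_succ]
      push_cast
      field_simp
      ring
  rw [h]
  have : (0 : ℝ) ≤ (2 * K + 4) / 2 ^ K := by positivity
  linarith

variable {H : Type*} [NormedAddCommGroup H] [InnerProductSpace ℝ H] {d m N : ℕ} {n : ℝ}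
  {w : Fin m → H}

lemma inner_sum_smul_sum_smul (w : Fin m → H) (x y : Fin m → ℝ) :
    inner ℝ (∑ i, x i • w i) (∑ j, y j • w j) = ∑ i, ∑ j, x i * y j * inner ℝ (w i) (w j) := by
  simp_rw [sum_inner, inner_sum, real_inner_smul_left, inner_smul_right, mul_assoc]

lemma restrict_mem_dyadicVectors {x : Fin m → ℝ} (hx : x ∈ dyadicVectors m 0 N n)
    {p : ℝ → Prop} [DecidablePred p] {k M : ℕ}
    (h : ∀ (l : ℕ) (v : ℝ), l ≤ N → |v| = 2 ^ l → p v → k ≤ l ∧ l ≤ M) :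
    (fun i => if p (x i) then x i else 0) ∈ dyadicVectors m k M n := by
  obtain ⟨h1, h2⟩ := mem_dyadicVectors.1 hx
  refine mem_dyadicVectors.2 ⟨fun i => mem_dyadicValues.2 ?_, le_trans ?_ h2⟩
  · split_ifs with hp
    · rcases mem_dyadicValues.1 (h1 i) with h0 | ⟨l, -, hl, hxl⟩
      · exact Or.inl h0
      · obtain ⟨h3, h4⟩ := h l _ hl hxl hp
        exact Or.inr ⟨l, h3, h4, hxl⟩
    · exact Or.inl rfl
  · refine Finset.sum_le_sum fun i _ => ?_
    split_ifs
    · exact le_rfl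
    · rw [zero_pow two_ne_zero]; positivity

/-- Summing the level bounds over all pairs of levels. -/
lemma LevelBounds.inner_le (hw : LevelBounds d N n w) (hn : 0 ≤ n) {M : ℝ} (hM0 : 0 ≤ M)
    (hM : ∀ y ∈ dyadicVectors m 0 N n, ‖∑ j, y j • w j‖ ≤ M) {x y : Fin m → ℝ}
    (hx : x ∈ dyadicVectors m 0 N n) (hy : y ∈ dyadicVectors m 0 N n)
    (hxy : ∀ i, x i * y i = 0) :
    inner ℝ (∑ i, x i • w i) (∑ j, y j • w j) ≤ 960 * (n / d) * M := by
  have hinj : ∀ a k : ℕ, ((2 : ℝ) ^ a = 2 ^ k → a = k) := fun a k =>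
    (pow_right_inj₀ (by norm_num) (by norm_num)).1
  have hle : ∀ a k : ℕ, ((2 : ℝ) ^ a ≤ 2 ^ k → a ≤ k) := fun a k =>
    (pow_le_pow_iff_right₀ (by norm_num)).1
  have hmono : ∀ k, ∀ y ∈ dyadicVectors m k N n, y ∈ dyadicVectors m 0 N n := by
    intro k y hy
    obtain ⟨h1, h2⟩ := mem_dyadicVectors.1 hy
    refine mem_dyadicVectors.2 ⟨fun i => mem_dyadicValues.2 ?_, h2⟩
    refine (mem_dyadicValues.1 (h1 i)).imp_right ?_
    rintro ⟨l, _, h⟩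
    exact ⟨l, Nat.zero_le _, h⟩
  have hpair : ∀ k ≤ N, ∀ x ∈ dyadicVectors m k k n, ∀ y ∈ dyadicVectors m k N n,
      (∀ i, x i * y i = 0) →
      ∑ i, ∑ j, x i * y j * inner ℝ (w i) (w j) ≤ 120 * (n / d) * M * ((k + 1) / 2 ^ k) := by
    intro k hk x hx y hy h0
    rw [← inner_sum_smul_sum_smul]
    refine (hw k hk x hx y hy h0).trans ?_
    have h1 := hM y (hmono k y hy)
    have h2 : 0 ≤ 2 ^ k * (120 / (d : ℝ)) * levelEntropy n k :=
      mul_nonneg (by positivity) (levelEntropy_nonneg hn k)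
    refine (mul_le_mul_of_nonneg_left h1 h2).trans (le_of_eq ?_)
    have e : (4 : ℝ) ^ k = 2 ^ k * 2 ^ k := by rw [← mul_pow]; norm_num
    rw [levelEntropy, e]
    field_simp
  obtain ⟨hx1, -⟩ := mem_dyadicVectors.1 hx
  obtain ⟨hy1, -⟩ := mem_dyadicVectors.1 hy
  have hz : ∀ (i : Fin m) (p q : Prop) [Decidable p] [Decidable q],
      (if p then x i else 0) * (if q then y i else 0) = 0 := by
    intro i p q _ _
    split_ifs <;> simp [hxy]
  rw [inner_sum_smul_sum_smul]
  have e : ∀ i j, x i * y j * inner ℝ (w i) (w j) = ∑ k ∈ Finset.range (N + 1),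
      ((if |x i| = 2 ^ k then x i else 0) * (if 2 ^ k ≤ |y j| then y j else 0)
          * inner ℝ (w i) (w j) +
        (if |y j| = 2 ^ k then y j else 0) * (if 2 ^ k < |x i| then x i else 0)
          * inner ℝ (w j) (w i)) := by
    intro i j
    conv_lhs => rw [mul_eq_sum_levels (hx1 i) (hy1 j), Finset.sum_mul]
    refine Finset.sum_congr rfl fun k _ => ?_
    rw [real_inner_comm (w i) (w j)]; ring
  simp_rw [e]
  have e2 : ∀ F : Fin m → Fin m → ℕ → ℝ, ∑ i, ∑ j, ∑ k ∈ Finset.range (N + 1), F i j k =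
      ∑ k ∈ Finset.range (N + 1), ∑ i, ∑ j, F i j k := by
    intro F
    rw [Finset.sum_comm' (s := Finset.range (N + 1)) (t := fun _ => Finset.univ)
      (s' := fun _ => Finset.range (N + 1)) (t' := Finset.univ) (by simp)]
    exact Finset.sum_congr rfl fun i _ => Finset.sum_comm
  rw [e2]
  -- Each level carries two decoupled forms, with the roles of x and y exchanged, each bounded with
  -- constant 120.
  calc _ ≤ ∑ k ∈ Finset.range (N + 1), 240 * (n / d) * M * (((k : ℝ) + 1) / 2 ^ k) := by
        refine Finset.sum_le_sum fun k hk => ?_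
        have hkN : k ≤ N := Nat.lt_succ_iff.1 (Finset.mem_range.1 hk)
        simp_rw [Finset.sum_add_distrib]
        rw [Finset.sum_comm (f := fun i j => (if |y j| = 2 ^ k then y j else 0) *
          (if 2 ^ k < |x i| then x i else 0) * inner ℝ (w j) (w i))]
        have h1 := hpair k hkN _
          (restrict_mem_dyadicVectors hx (p := fun v => |v| = 2 ^ k) (k := k) (M := k)
            fun l v _ h h' => by
              obtain rfl := hinj _ _ (h.symm.trans h'); simp) _
          (restrict_mem_dyadicVectors hy (p := fun v => 2 ^ k ≤ |v|) (k := k) (M := N)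
            fun l v hl h h' => ⟨hle _ _ (h ▸ h'), hl⟩) (fun i => hz i _ _)
        have h2 := hpair k hkN _
          (restrict_mem_dyadicVectors hy (p := fun v => |v| = 2 ^ k) (k := k) (M := k)
            fun l v _ h h' => by
              obtain rfl := hinj _ _ (h.symm.trans h'); simp) _
          (restrict_mem_dyadicVectors hx (p := fun v => 2 ^ k < |v|) (k := k) (M := N)
            fun l v hl h h' => ⟨hle _ _ (h ▸ h'.le), hl⟩)
          (fun i => by rw [mul_comm]; exact hz i _ _)
        linarith
    _ = 240 * (n / d) * M * ∑ k ∈ Finset.range (N + 1), ((k : ℝ) + 1) / 2 ^ k := by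
        rw [Finset.mul_sum]
    _ ≤ 240 * (n / d) * M * 4 := by
        gcongr
        exact sum_range_add_one_div_two_pow_le _
    _ = _ := by ring

end levels

/-! ### Operator norm and quadratic forms -/

section opNorm
variable {m : ℕ}

lemma inner_toEuclideanCLM_self (A : Matrix (Fin m) (Fin m) ℝ) (x : EuclideanSpace ℝ (Fin m)) :
    inner ℝ (Matrix.toEuclideanCLM (n := Fin m) (𝕜 := ℝ) A x) x =
      ∑ i, ∑ j, A i j * (x i * x j) := by
  rw [real_inner_comm, Matrix.inner_toEuclideanCLM]
  simp only [dotProduct, Matrix.mulVec, Finset.mul_sum]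
  exact Finset.sum_congr rfl fun i _ => Finset.sum_congr rfl fun j _ => by ring

lemma abs_quadForm_le_opNorm (A : Matrix (Fin m) (Fin m) ℝ) (x : Fin m → ℝ) :
    |∑ i, ∑ j, A i j * (x i * x j)| ≤ opNorm A * ∑ i, x i ^ 2 := by
  have h := inner_toEuclideanCLM_self A (WithLp.toLp 2 x)
  have h2 := EuclideanSpace.real_norm_sq_eq (WithLp.toLp 2 x)
  simp only at h h2
  rw [← h, ← h2, pow_two, ← mul_assoc]
  refine (abs_real_inner_le_norm _ _).trans ?_
  gcongr
  exact ContinuousLinearMap.le_opNorm _ _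

lemma opNorm_le_of_abs_quadForm_le {A : Matrix (Fin m) (Fin m) ℝ} (hA : ∀ i j, A i j = A j i)
    {q : ℝ} (hq : 0 ≤ q) (h : ∀ x : Fin m → ℝ, 0 < ∑ i, x i ^ 2 →
      |∑ i, ∑ j, A i j * (x i * x j)| ≤ q * ∑ i, x i ^ 2) : opNorm A ≤ q := by
  have hT : A.transpose = A := by ext i j; exact hA j i
  have hsymm : (Matrix.toEuclideanCLM (n := Fin m) (𝕜 := ℝ) A).IsSymmetric := by
    intro x y
    simp only [ContinuousLinearMap.coe_coe]
    rw [real_inner_comm, Matrix.inner_toEuclideanCLM, Matrix.inner_toEuclideanCLM,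
      Matrix.dotProduct_mulVec, ← Matrix.mulVec_transpose, hT, dotProduct_comm]
  refine (ContinuousLinearMap.norm_eq_iSup_rayleighQuotient _ hsymm).trans_le
    (ciSup_le fun x => ?_)
  rcases eq_or_ne x 0 with rfl | hx
  · simpa using hq
  · have hpos : 0 < ‖x‖ ^ 2 := by positivity
    rw [ContinuousLinearMap.rayleighQuotient, ContinuousLinearMap.reApplyInnerSelf_apply,
      RCLike.re_to_real, inner_toEuclideanCLM_self, abs_div, abs_of_pos hpos, div_le_iff₀ hpos,
      EuclideanSpace.real_norm_sq_eq]
    rw [EuclideanSpace.real_norm_sq_eq] at hpos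
    exact h x hpos

end opNorm

/-! ### The self-bounding estimate for the Gram matrix -/

section gram
variable {H : Type*} [NormedAddCommGroup H] [InnerProductSpace ℝ H] {d m N : ℕ} {n : ℝ}
  {w : Fin m → H}

lemma mul_mem_dyadicVectors {k N : ℕ} {x s : Fin m → ℝ} (hx : x ∈ dyadicVectors m k N n)
    (hs : ∀ i, s i = 0 ∨ |s i| = 1) : (fun i => s i * x i) ∈ dyadicVectors m k N n := by
  obtain ⟨h1, h2⟩ := mem_dyadicVectors.1 hx
  refine mem_dyadicVectors.2 ⟨fun i => mem_dyadicValues.2 ?_, le_trans ?_ h2⟩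
  · rcases hs i with h | h
    · simp [h]
    · rcases mem_dyadicValues.1 (h1 i) with h3 | ⟨l, h3, h4, h5⟩
      · simp [h3]
      · exact Or.inr ⟨l, h3, h4, by rw [abs_mul, h, one_mul, h5]⟩
  · refine Finset.sum_le_sum fun i _ => ?_
    rw [mul_pow]
    have : s i ^ 2 ≤ 1 := by
      rcases hs i with h | h
      · simp [h]
      · rw [← sq_abs, h]; simp
    exact mul_le_of_le_one_left (sq_nonneg _) this

/-- Deterministic part: level bounds control the off-diagonal Gram matrix. -/
lemma LevelBounds.opNorm_le (hw : LevelBounds d N n w) (hd : 0 < d)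
    (hn : n = ((d : ℝ) / 240000) ^ 2) (hm : (m : ℝ) ≤ n) (hN : 5 * n < 4 ^ (N + 1))
    (hR : ∀ i, ‖w i‖ ^ 2 ≤ 2) {A : Matrix (Fin m) (Fin m) ℝ}
    (hA : ∀ i j, A i j = if i = j then 0 else inner ℝ (w i) (w j)) : opNorm A ≤ 0.1 := by
  have hd' : (0 : ℝ) < d := by exact_mod_cast hd
  have hn0 : 0 < n := by rw [hn]; positivity
  have hA0 : ∀ i, A i i = 0 := fun i => by rw [hA, if_pos rfl]
  have hAne : ∀ i j, i ≠ j → A i j = inner ℝ (w i) (w j) := fun i j h => by rw [hA, if_neg h]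
  set B := opNorm A with hB
  have hB0 : 0 ≤ B := norm_nonneg _
  set M : ℝ := √(5 * n * (B + 2)) with hM
  -- ‖Σ y_j w_j‖² is the off-diagonal form plus Σ y_i² ‖w_i‖², so the unknown norm B itself controls
  -- it.
  have hMb : ∀ y ∈ dyadicVectors m 0 N n, ‖∑ j, y j • w j‖ ≤ M := by
    intro y hy
    apply Real.le_sqrt_of_sq_le
    rw [← real_inner_self_eq_norm_sq, inner_sum_smul_sum_smul]
    have e : ∑ i, ∑ j, y i * y j * inner ℝ (w i) (w j) =
        ∑ i, ∑ j, A i j * (y i * y j) + ∑ i, y i ^ 2 * ‖w i‖ ^ 2 := by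
      rw [← Finset.sum_add_distrib]
      refine Finset.sum_congr rfl fun i _ => ?_
      have e1 : ∀ j, y i * y j * inner ℝ (w i) (w j) =
          A i j * (y i * y j) + if i = j then y i ^ 2 * ‖w i‖ ^ 2 else 0 := by
        intro j
        split_ifs with h
        · subst h
          rw [hA0, real_inner_self_eq_norm_sq]; ring
        · rw [hAne i j h]; ring
      simp_rw [e1, Finset.sum_add_distrib]
      simp
    rw [e]
    have h1 := (le_abs_self _).trans (abs_quadForm_le_opNorm A y)
    have h2 : ∑ i, y i ^ 2 * ‖w i‖ ^ 2 ≤ (∑ i, y i ^ 2) * 2 := by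
      rw [Finset.sum_mul]
      exact Finset.sum_le_sum fun i _ => mul_le_mul_of_nonneg_left (hR i) (sq_nonneg _)
    have h3 := (mem_dyadicVectors.1 hy).2
    nlinarith [mul_le_mul_of_nonneg_right h3 (by linarith : 0 ≤ B + 2)]
  -- The sign σ yields both sides of the absolute value; 3840 is 960 times the decoupling factor 4.
  have key : ∀ σ : ℝ, |σ| = 1 → ∀ z : Fin m → ℝ, ∑ i, z i ^ 2 ≤ n →
      σ * ∑ i, ∑ j, A i j * (z i * z j) ≤ 3840 * (n / d) * M := by
    intro σ hσ z hz
    obtain ⟨ξ, hξ, h1⟩ := exists_dyadicVectors_le hm hN (A := fun i j => σ * A i j)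
      (fun i => by simp [hA0]) hz
    obtain ⟨p, hp, h2⟩ := exists_decoupling (A := fun i j => σ * A i j * (ξ i * ξ j))
      (fun i => by simp [hA0])
    have hx := mul_mem_dyadicVectors hξ (s := fun i => σ * p i) fun i => by
      rcases hp i with h | h
      · left; simp [h]
      · right; simp [h, hσ]
    have hy := mul_mem_dyadicVectors hξ (s := fun i => 1 - p i) fun i => by
      rcases hp i with h | h
      · right; simp [h]
      · left; simp [h]
    have hp' : ∀ i, p i * (1 - p i) = 0 := fun i => by
      rcases hp i with h | h <;> simp [h]
    have h3 := hw.inner_le hn0.le (Real.sqrt_nonneg _) hMb hx hy fun i => by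
      linear_combination σ * ξ i ^ 2 * hp' i
    rw [inner_sum_smul_sum_smul] at h3
    have e : ∀ i j, σ * p i * ξ i * ((1 - p j) * ξ j) * inner ℝ (w i) (w j) =
        σ * A i j * (ξ i * ξ j) * (p i * (1 - p j)) := by
      intro i j
      rcases eq_or_ne i j with rfl | h
      · rw [hA0]; linear_combination σ * ξ i ^ 2 * inner ℝ (w i) (w i) * hp' i
      · rw [hAne i j h]; ring
    simp_rw [e] at h3
    calc σ * ∑ i, ∑ j, A i j * (z i * z j) = ∑ i, ∑ j, σ * A i j * (z i * z j) := by
          simp_rw [Finset.mul_sum, mul_assoc]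
      _ ≤ _ := by linarith
  -- By homogeneity, any nonzero test vector is rescaled to squared norm n.
  have hBM : B ≤ 3840 / d * M := by
    refine opNorm_le_of_abs_quadForm_le (fun i j => ?_) (by positivity) fun x hx => ?_
    · rw [hA, hA, real_inner_comm]
      simp only [eq_comm]
    · set S := ∑ i, x i ^ 2 with hS
      set r := √(n / S) with hr
      have hr2 : r ^ 2 = n / S := Real.sq_sqrt (by positivity)
      have hz : ∑ i, (r * x i) ^ 2 ≤ n := by
        simp_rw [mul_pow, ← Finset.mul_sum, hr2, ← hS]
        rw [div_mul_cancel₀ _ hx.ne']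
      have e : ∑ i, ∑ j, A i j * (r * x i * (r * x j)) =
          n / S * ∑ i, ∑ j, A i j * (x i * x j) := by
        simp_rw [← hr2, Finset.mul_sum]
        exact Finset.sum_congr rfl fun i _ => Finset.sum_congr rfl fun j _ => by ring
      have h1 := key 1 (by simp) _ hz
      have h2 := key (-1) (by simp) _ hz
      rw [e] at h1 h2
      have hpos : 0 < n / S := by positivity
      have e2 : 3840 * (n / d) * M = n / S * (3840 / d * M * S) := by
        field_simp
      rw [e2] at h1 h2
      rw [abs_le]
      constructor
      · have : n / S * (-∑ i, ∑ j, A i j * (x i * x j)) ≤ n / S * (3840 / d * M * S) := by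
          linarith
        linarith [le_of_mul_le_mul_left this hpos]
      · rw [one_mul] at h1
        exact le_of_mul_le_mul_left h1 hpos
  have hsq : B ^ 2 ≤ (3840 / d * M) ^ 2 := by gcongr
  have hM2 : M ^ 2 = 5 * n * (B + 2) := Real.sq_sqrt (by positivity)
  -- The choice of n cancels d: 5 · (3840/240000)² = 0.00128. Any B > 0.1 would violate B² ≤
  -- 0.00128(B + 2).
  have e : (3840 / d * M) ^ 2 = 0.00128 * (B + 2) := by
    rw [mul_pow, hM2, hn]; field_simp; norm_num
  rw [e] at hsq
  by_contra hlt
  push Not at hlt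
  nlinarith

end gram

/-! ### The diagonal matrix and the combined failure probability -/

/-- With q = ‖v_i‖², the entry is (q - 1)(q + 1) - 2q/d, and q ≤ 1.1 gives the constants 2.1 and
2.2. -/
lemma opNorm_Mdiag_le {d m : ℕ} {v : Fin m → EuclideanSpace ℝ (Fin d)} {s : ℝ} (hs0 : 0 ≤ s)
    (hs : s ≤ 0.1) (h : ∀ i, |‖v i‖ ^ 2 - 1| ≤ s) :
    opNorm (Mdiag v) ≤ 2.1 * s + 2.2 / d := by
  have hd0 : (0 : ℝ) ≤ 1 / d := by positivity
  have hentry : ∀ i, |‖v i‖ ^ 4 - 2 / (d : ℝ) * ‖v i‖ ^ 2 - 1| ≤ 2.1 * s + 2.2 / d := by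
    intro i
    obtain ⟨h1, h2⟩ := abs_le.1 (h i)
    set q := ‖v i‖ ^ 2 with hq
    have hq0 : 0 ≤ q := by positivity
    have e : ‖v i‖ ^ 4 = q ^ 2 := by rw [hq]; ring
    have e1 : 2 / (d : ℝ) = 2 * (1 / d) := by ring
    have e2 : 2.2 / (d : ℝ) = 2.2 * (1 / d) := by ring
    rw [e, e1, e2, abs_le]
    have h3 := mul_le_mul_of_nonneg_left (by linarith : q ≤ 1.1) hd0
    have h4 := mul_nonneg hd0 hq0
    constructor <;> nlinarith
  refine opNorm_le_of_abs_quadForm_le (fun i j => ?_) (by positivity) fun x _ => ?_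
  · simp only [Mdiag, Matrix.diagonal_apply]
    split_ifs with h1 h2 h2
    · rw [h1]
    · exact absurd h1.symm h2
    · exact absurd h2.symm h1
    · rfl
  · have e : ∑ i, ∑ j, Mdiag v i j * (x i * x j) =
        ∑ i, (‖v i‖ ^ 4 - 2 / (d : ℝ) * ‖v i‖ ^ 2 - 1) * x i ^ 2 := by
      refine Finset.sum_congr rfl fun i _ => ?_
      simp only [Mdiag, Matrix.diagonal_apply, ite_mul, zero_mul]
      rw [Finset.sum_ite_eq, if_pos (Finset.mem_univ _)]
      ring
    rw [e, Finset.mul_sum]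
    refine (Finset.abs_sum_le_sum_abs _ _).trans (Finset.sum_le_sum fun i _ => ?_)
    rw [abs_mul, abs_of_nonneg (sq_nonneg (x i))]
    exact mul_le_mul_of_nonneg_right (hentry i) (sq_nonneg _)

lemma measure_pi_not_levelBounds_le {d m N : ℕ} {n : ℝ} {H : Type*} [NormedAddCommGroup H]
    [InnerProductSpace ℝ H] [MeasurableSpace H] [BorelSpace H] [SecondCountableTopology H]
    {E : Type*} [MeasurableSpace E] {γ : Measure E} [IsProbabilityMeasure γ] {φ : E → H}
    (hφ : Measurable φ) (hsub : HasSubexpMarginals d (γ.map φ)) (hd : 0 < d)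
    (hm : (m : ℝ) ≤ n) (hN : (4 : ℝ) ^ N ≤ 5 * n) :
    (Measure.pi fun _ : Fin m => γ) {v | ¬ LevelBounds d N n fun i => φ (v i)} ≤
      ENNReal.ofReal ((N + 1) * Real.exp (-(N + 1))) := by
  have hind : iIndepFun (fun (i : Fin m) (v : Fin m → E) => φ (v i))
      (Measure.pi fun _ : Fin m => γ) :=
    iIndepFun_pi (μ := fun _ : Fin m => γ) (X := fun _ => φ) fun _ => hφ.aemeasurable
  have hmeas : ∀ i : Fin m, Measurable fun v : Fin m → E => φ (v i) :=
    fun i => hφ.comp (measurable_pi_apply i)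
  refine measure_not_levelBounds_le hd hm hN hmeas hind fun i => ?_
  have h : (Measure.pi fun _ : Fin m => γ).map (fun v => φ (v i)) = γ.map φ :=
    (Measure.map_map hφ (measurable_pi_apply i)).symm.trans
      (congrArg _ (measurePreserving_eval (fun _ : Fin m => γ) i).map_eq)
  rwa [h]

/-- The three bounds of the theorem. -/
def SpectralBounds {d m : ℕ} (C : ℝ) (v : Fin m → EuclideanSpace ℝ (Fin d)) : Prop :=
  opNorm (Malpha v) ≤ 0.1 ∧ opNorm (Mbeta v) ≤ 0.1 ∧
    opNorm (Mdiag v) ≤ C * √(Real.log d / d)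

/-- The dimension is large enough for the asymptotic estimates. -/
def IsLargeDim (d : ℕ) : Prop :=
  2 ≤ d ∧ 1 ≤ Real.log d ∧ 2500 * Real.log d ≤ d ∧ 1 ≤ 5 * ((d : ℝ) / 240000) ^ 2

/-- The number of dyadic levels in dimension `d`. -/
noncomputable def levelCount (d : ℕ) : ℕ := Nat.log 4 ⌊5 * ((d : ℝ) / 240000) ^ 2⌋₊

lemma measure_pi_not_spectralBounds_le {d m : ℕ} (hd : IsLargeDim d)
    (hm : (m : ℝ) ≤ ((d : ℝ) / 240000) ^ 2) :
    (Measure.pi fun _ : Fin m =>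
      multivariateGaussian 0 ((1 / (d : ℝ)) • (1 : Matrix (Fin d) (Fin d) ℝ)))
      {v | ¬ SpectralBounds 20 v} ≤
      ENNReal.ofReal (2 * ((levelCount d + 1) * Real.exp (-(levelCount d + 1))) + 2 / d) := by
  obtain ⟨hd2, hlog, hdlog, hd5⟩ := hd
  have hd0 : 0 < d := by omega
  have hd' : (0 : ℝ) < d := by exact_mod_cast hd0
  set γ := multivariateGaussian 0 ((1 / (d : ℝ)) • (1 : Matrix (Fin d) (Fin d) ℝ)) with hγ
  set n : ℝ := ((d : ℝ) / 240000) ^ 2 with hn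
  set N := levelCount d with hNdef
  have hfl : ⌊5 * n⌋₊ ≠ 0 := (Nat.floor_pos.2 hd5).ne'
  have hN1 : (4 : ℝ) ^ N ≤ 5 * n := by
    have h1 : 4 ^ N ≤ ⌊5 * n⌋₊ := Nat.pow_log_le_self 4 hfl
    calc (4 : ℝ) ^ N ≤ (⌊5 * n⌋₊ : ℝ) := by exact_mod_cast h1
      _ ≤ 5 * n := Nat.floor_le (by positivity)
  have hN2 : 5 * n < 4 ^ (N + 1) := by
    have h1 : ⌊5 * n⌋₊ < 4 ^ (N + 1) := Nat.lt_pow_succ_log_self (by norm_num) _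
    rw [Nat.floor_lt (by positivity)] at h1
    exact_mod_cast h1
  set L : ℝ := √(Real.log d / d) with hL
  have hL0 : 0 ≤ L := Real.sqrt_nonneg _
  have hL2 : L ^ 2 = Real.log d / d := Real.sq_sqrt (by positivity)
  have hLs : L ≤ 1 / 50 := by
    apply le_of_sq_le_sq _ (by norm_num)
    rw [hL2, div_le_iff₀ hd']
    linarith
  have hLd : 1 / (d : ℝ) ≤ L := by
    apply Real.le_sqrt_of_sq_le
    rw [div_pow, one_pow, pow_two, div_le_div_iff₀ (by positivity) hd']
    have : (1 : ℝ) ≤ d := by exact_mod_cast hd0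
    nlinarith [mul_nonneg (by linarith : (0 : ℝ) ≤ Real.log d - 1) (mul_pos hd' hd').le]
  have hα := measure_pi_not_levelBounds_le measurable_offDiagFeature
    (hasSubexpMarginals_offDiagFeature hd0) hd0 hm hN1
  have hβ := measure_pi_not_levelBounds_le measurable_diagFeature
    (hasSubexpMarginals_diagFeature hd0) hd0 hm hN1
  have hD : (Measure.pi fun _ : Fin m => γ) (⋃ i, {v | 5 * L ≤ |‖v i‖ ^ 2 - 1|}) ≤
      ENNReal.ofReal (2 / d) := by
    have h1 : ∀ i : Fin m, (Measure.pi fun _ : Fin m => γ) {v | 5 * L ≤ |‖v i‖ ^ 2 - 1|} ≤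
        ENNReal.ofReal (2 / d ^ 3) := by
      intro i
      -- Here the exponent is 2dL² - 5dL² = -3 log d; the resulting 2/d³ survives a union over m ≤
      -- d² indices.
      have h2 := measure_norm_sq_sub_one_ge hd0 (θ := d * L) (s := 5 * L) (by positivity)
        (by nlinarith)
      have hms : MeasurableSet {v : EuclideanSpace ℝ (Fin d) | 5 * L ≤ |‖v‖ ^ 2 - 1|} :=
        measurableSet_le measurable_const (by fun_prop)
      have h3 := (measurePreserving_eval (fun _ : Fin m => γ) i).measure_preimage
        hms.nullMeasurableSet
      refine (h3.trans_le h2).trans (ENNReal.ofReal_le_ofReal (le_of_eq ?_))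
      have e : 2 * (d * L) ^ 2 / d - d * L * (5 * L) = -((3 : ℕ) * Real.log d) := by
        have : 2 * (d * L) ^ 2 / d - d * L * (5 * L) = -3 * d * L ^ 2 := by
          field_simp; ring
        rw [this, hL2]; push_cast; field_simp
      rw [e, Real.exp_neg, Real.exp_nat_mul, Real.exp_log hd', div_eq_mul_inv]
    calc _ ≤ ∑ i : Fin m, ENNReal.ofReal (2 / (d : ℝ) ^ 3) :=
          (measure_iUnion_fintype_le _ _).trans (Finset.sum_le_sum fun i _ => h1 i)
      _ = ENNReal.ofReal (m * (2 / (d : ℝ) ^ 3)) := by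
          rw [ENNReal.ofReal_mul (by positivity)]; simp
      _ ≤ _ := by
          apply ENNReal.ofReal_le_ofReal
          calc m * (2 / (d : ℝ) ^ 3) ≤ (d : ℝ) ^ 2 * (2 / (d : ℝ) ^ 3) := by
                gcongr
                refine hm.trans ?_
                rw [hn, div_pow]
                exact div_le_self (by positivity) (by norm_num)
            _ = _ := by field_simp
  have hsubset : {v : Fin m → EuclideanSpace ℝ (Fin d) | ¬ SpectralBounds 20 v} ⊆
      ({v | ¬ LevelBounds d N n fun i => offDiagFeature (v i)} ∪
        {v | ¬ LevelBounds d N n fun i => diagFeature (v i)}) ∪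
        ⋃ i, {v | 5 * L ≤ |‖v i‖ ^ 2 - 1|} := by
    intro v hv
    by_contra hnot
    simp only [Set.mem_union, Set.mem_iUnion, Set.mem_ofPred_eq, not_or, not_not, not_exists,
      not_le] at hnot
    obtain ⟨⟨h1, h2⟩, h3⟩ := hnot
    have h4 : ∀ i, (‖v i‖ ^ 2) ^ 2 ≤ 1.5 := by
      intro i
      have := (abs_lt.1 (h3 i)).2
      have h5 : ‖v i‖ ^ 2 ≤ 1.1 := by linarith
      nlinarith [sq_nonneg ‖v i‖]
    have hd1 : 1 / (d : ℝ) ≤ 0.5 := by linarith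
    refine hv ⟨?_, ?_, ?_⟩
    · exact h1.opNorm_le hd0 hn hm hN2
        (fun i => (norm_sq_offDiagFeature_le _).trans ((h4 i).trans (by norm_num)))
        (Malpha_apply_eq_inner v)
    · exact h2.opNorm_le hd0 hn hm hN2
        (fun i => (norm_sq_diagFeature_le hd0 _).trans (by linarith [h4 i]))
        (Mbeta_apply_eq_inner v)
    -- Since 1/d ≤ L, the bound is at most 10.5 L + 2.2 L, below 20 L.
    · refine (opNorm_Mdiag_le (s := 5 * L) (by positivity) (by linarith)
        fun i => (h3 i).le).trans ?_
      have e : 2.2 / (d : ℝ) = 2.2 * (1 / d) := by ring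
      rw [e]
      linarith
  refine (measure_mono hsubset).trans ((measure_union_le _ _).trans ?_)
  rw [ENNReal.ofReal_add (by positivity) (by positivity), two_mul,
    ENNReal.ofReal_add (by positivity) (by positivity)]
  exact add_le_add ((measure_union_le _ _).trans (add_le_add hα hβ)) hD

/-! ### Asymptotics of the failure probability and conclusion -/

lemma eventually_isLargeDim : ∀ᶠ d : ℕ in atTop, IsLargeDim d := by
  have hcast : Tendsto (fun d : ℕ => (d : ℝ)) atTop atTop := tendsto_natCast_atTop_atTop
  have h1 : ∀ᶠ d : ℕ in atTop, 1 ≤ Real.log d :=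
    (Real.tendsto_log_atTop.comp hcast).eventually_ge_atTop 1
  have h2 : ∀ᶠ d : ℕ in atTop, ‖Real.log d‖ ≤ 1 / 2500 * ‖(d : ℝ)‖ :=
    hcast.eventually (Real.isLittleO_log_id_atTop.bound (by norm_num : (0 : ℝ) < 1 / 2500))
  filter_upwards [eventually_ge_atTop 2, h1, h2, hcast.eventually_ge_atTop 240000]
    with d hd h1 h2 h3
  refine ⟨hd, h1, ?_, ?_⟩
  · rw [Real.norm_of_nonneg (by linarith), Real.norm_of_nonneg (by positivity)] at h2
    linarith
  · have : 1 ≤ (d : ℝ) / 240000 := by rw [le_div_iff₀ (by norm_num)]; linarith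
    nlinarith

lemma tendsto_levelCount : Tendsto levelCount atTop atTop := by
  have h1 : Tendsto (Nat.log 4) atTop atTop :=
    tendsto_atTop_atTop_of_monotone Nat.log_monotone
      fun b => ⟨4 ^ b, (Nat.log_pow (by norm_num) b).ge⟩
  have h2 : Tendsto (fun d : ℕ => 5 * ((d : ℝ) / 240000) ^ 2) atTop atTop := by
    refine Tendsto.const_mul_atTop (by norm_num) ?_
    exact (tendsto_pow_atTop two_ne_zero).comp
      (tendsto_natCast_atTop_atTop.atTop_div_const (by norm_num))
  exact h1.comp (tendsto_nat_floor_atTop.comp h2)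

/-- The failure probability. -/
noncomputable def failureBound (d : ℕ) : ℝ := by
  classical
  exact 2 * ((levelCount d + 1) * Real.exp (-(levelCount d + 1))) + 2 / d +
    if IsLargeDim d then 0 else 1

lemma failureBound_eq {d : ℕ} (hd : IsLargeDim d) :
    failureBound d = 2 * ((levelCount d + 1) * Real.exp (-(levelCount d + 1))) + 2 / d := by
  simp [failureBound, hd]

/-- In the remaining dimensions the probability claim becomes trivial, so no estimate is needed
there. -/
lemma one_le_failureBound {d : ℕ} (hd : ¬ IsLargeDim d) : 1 ≤ failureBound d := by
  simp only [failureBound, if_neg hd]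
  have : 0 ≤ 2 * (((levelCount d : ℝ) + 1) * Real.exp (-(levelCount d + 1))) + 2 / d := by
    positivity
  linarith

lemma tendsto_failureBound : Tendsto failureBound atTop (𝓝 0) := by
  have h0 : Tendsto (fun d : ℕ => (levelCount d : ℝ) + 1) atTop atTop :=
    tendsto_atTop_add_const_right _ _ (tendsto_natCast_atTop_atTop.comp tendsto_levelCount)
  have h1 := (Real.tendsto_pow_mul_exp_neg_atTop_nhds_zero 1).comp h0
  have h2 : Tendsto (fun d : ℕ => 2 / (d : ℝ)) atTop (𝓝 0) :=
    tendsto_const_nhds.div_atTop tendsto_natCast_atTop_atTop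
  have h3 := (h1.const_mul 2).add h2
  simp only [mul_zero, add_zero] at h3
  refine h3.congr' ?_
  filter_upwards [eventually_isLargeDim] with d hd
  rw [failureBound_eq hd]
  simp

/-- Transfer to the product Gaussian measure. An inequality suffices for failure events and holds
for every set, so measurability of the spectral events is never needed. -/
lemma IsIIDGaussianSample.measure_preimage_le {Ω : Type*} [MeasurableSpace Ω] {P : Measure Ω}
    {d m : ℕ} {v : Fin m → Ω → EuclideanSpace ℝ (Fin d)} (hv : IsIIDGaussianSample P d m v)
    (s : Set (Fin m → EuclideanSpace ℝ (Fin d))) :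
    P {ω | (fun i => v i ω) ∈ s} ≤ (Measure.pi fun _ : Fin m =>
      multivariateGaussian 0 ((1 / (d : ℝ)) • (1 : Matrix (Fin d) (Fin d) ℝ))) s := by
  have hP : IsProbabilityMeasure P := hv.indep.isProbabilityMeasure
  have hae : ∀ i, AEMeasurable (v i) P := fun i => (hv.law i).aemeasurable
  have h := (iIndepFun_iff_map_fun_eq_pi_map hae).1 hv.indep
  simp_rw [fun i => (hv.law i).map_eq] at h
  rw [← h]
  exact Measure.le_map_apply (aemeasurable_pi_lambda _ hae) s

theorem mainTheorem3 :
    ∃ c : ℝ, 0 < c ∧ ∃ C : ℝ, 0 < C ∧ ∃ ε : ℕ → ℝ, Tendsto ε atTop (𝓝 0) ∧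
      ∀ d m : ℕ, (m : ℝ) ≤ c * (d : ℝ) ^ 2 →
        ∀ (Ω : Type*) [MeasurableSpace Ω] (P : Measure Ω) [IsProbabilityMeasure P]
          (v : Fin m → Ω → EuclideanSpace ℝ (Fin d)), IsIIDGaussianSample P d m v →
          1 - ε d ≤ P.real {ω | opNorm (Malpha fun i => v i ω) ≤ 0.1 ∧
            opNorm (Mbeta fun i => v i ω) ≤ 0.1 ∧
            opNorm (Mdiag fun i => v i ω) ≤ C * √(Real.log d / d)} := by
  refine ⟨(1 / 240000) ^ 2, by positivity, 20, by norm_num, failureBound, tendsto_failureBound, ?_⟩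
  intro d m hm Ω _ P _ v hv
  by_cases hd : IsLargeDim d
  swap
  · exact (sub_nonpos.2 (one_le_failureBound hd)).trans measureReal_nonneg
  have hm' : (m : ℝ) ≤ ((d : ℝ) / 240000) ^ 2 := by
    refine hm.trans (le_of_eq ?_); ring
  have hbad := (hv.measure_preimage_le {v | ¬ SpectralBounds 20 v}).trans
    (measure_pi_not_spectralBounds_le hd hm')
  rw [← failureBound_eq hd] at hbad
  have hpos : 0 ≤ failureBound d := by rw [failureBound_eq hd]; positivity
  have hbad' : P.real {ω | ¬ SpectralBounds 20 fun i => v i ω} ≤ failureBound d :=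
    ENNReal.toReal_le_of_le_ofReal hpos hbad
  have hun := measureReal_union_le (μ := P) {ω | SpectralBounds 20 fun i => v i ω}
    {ω | ¬ SpectralBounds 20 fun i => v i ω}
  have huniv : {ω | SpectralBounds 20 fun i => v i ω} ∪
      {ω | ¬ SpectralBounds 20 fun i => v i ω} = Set.univ := by
    ext ω
    simpa using em _
  rw [huniv, probReal_univ] at hun
  have : 1 - failureBound d ≤ P.real {ω | SpectralBounds 20 fun i => v i ω} := by linarith
  exact this
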